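/- Let $\mathcal S^7\subset\mathbb R^8$ be the unit sphere (coordinates $x_0,\dots,x_7$) and write $dx_{ijkl}=dx_i\wedge dx_j\wedge dx_k\wedge dx_l$. Let $$\Phi_0=dx_{0123}+dx_{0145}+dx_{0167}+dx_{0246}-dx_{0257}-dx_{0347}-dx_{0356}+dx_{4567}+dx_{2367}+dx_{2345}+dx_{1357}-dx_{1346}-dx_{1256}-dx_{1247},$$ let $\mathrm{Spin}(7)\subset SO(8)$ be its stabilizer, and give $\mathcal S^7$ (with the round metric) the $G_2$ structure $\varphi_x=\Phi_0(x,\cdot,\cdot,\cdot)|_{T_x\mathcal S^7}$. An oriented (immersed, smooth) 3-fold $A$ in $\mathcal S^7$ is *associative* if $\varphi|_A=\mathrm{vol}_A$. It is *totally geodesic* if its second fundamental form in $\mathcal S^7$ vanishes, and it *has flat normal bundle* if the curvature of the induced connection on its normal bundle in $\mathcal S^7$ vanishes. An *adapted frame* on $A$ is a smooth local map $g=(x,e_1,e_2,e_3,f_4,f_5,f_6,f_7)$ from $A$ to $\mathrm{Spin}(7)$ (given by its columns), where $x$ is the position vector, the $e_j$ are tangent to $A$ and the $f_a$ are normal to $A$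 in $\mathcal S^7$. Let $\omega_1,\omega_2,\omega_3$ be the coframe dual to $e_1,e_2,e_3$, put $\mu_{ab}=\langle f_a,df_b\rangle$ (the connection matrix of the normal bundle), and let $$\gamma=(\gamma_1,\gamma_2,\gamma_3)=(\mu_{54}-\mu_{76},\ \mu_{64}-\mu_{57},\ \mu_{56}-\mu_{47}),\qquad [\gamma]=\begin{pmatrix}0&\gamma_3&-\gamma_2\\-\gamma_3&0&\gamma_1\\ \gamma_2&-\gamma_1&0\end{pmatrix},$$ the anti-self-dual part of $\mu$. Define the tensor $R^-$ (the anti-self-dual part of the normal curvature) by $$d[\gamma]_{ij}+\sum_m[\gamma]_{im}\wedge[\gamma]_{mj}=\tfrac12\sum_{k,l}R^-_{ijkl}\,\omega_k\wedge\omega_l .$$ The vanishing of $R^-$ at a point does not depend on the choice of adapted frame near that point. **Proposition.** Let $A$ be an associative 3-fold in $\mathcal S^7$. 1. $A$ has flat normal bundle if and only if $A$ is totally geodesic. 2. If $R^-_{ijkl}=0$ for all $i,j,k,l$ at every point of $A$, then $A$ is totally geodesic. -/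

import Mathlib

open scoped Manifold ContDiff Topology RealInnerProductSpace

noncomputable section

namespace AssocS7

/-- The domain of the charts of a 3-manifold. -/
abbrev E3 : Type := EuclideanSpace ℝ (Fin 3)

/-- Euclidean 8-space, with coordinates `x 0, …, x 7`. -/
abbrev E8 : Type := EuclideanSpace ℝ (Fin 8)

/-- The unit sphere `S⁷ ⊆ ℝ⁸`, with the smooth structure provided by Mathlib. -/
abbrev S7 : Type := Metric.sphere (0 : E8) 1

instance factFinrankE8 : Fact (Module.finrank ℝ E8 = 7 + 1) := ⟨by simp⟩

/-! ### The `Spin(7)` structure of `ℝ⁸` and the `G₂` structure of `S⁷` -/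

/-- The constant 4-form `dx_i ∧ dx_j ∧ dx_k ∧ dx_l` on `ℝ⁸`. -/
def dx (i j k l : Fin 8) (a b c d : E8) : ℝ :=
  Matrix.det !![a i, b i, c i, d i;
                a j, b j, c j, d j;
                a k, b k, c k, d k;
                a l, b l, c l, d l]

/-- The `Spin(7)` 4-form (Cayley form) `Φ₀` on `ℝ⁸`. -/
def Phi (a b c d : E8) : ℝ :=
  dx 0 1 2 3 a b c d + dx 0 1 4 5 a b c d + dx 0 1 6 7 a b c d + dx 0 2 4 6 a b c d
    - dx 0 2 5 7 a b c d - dx 0 3 4 7 a b c d - dx 0 3 5 6 a b c d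
    + dx 4 5 6 7 a b c d + dx 2 3 6 7 a b c d + dx 2 3 4 5 a b c d + dx 1 3 5 7 a b c d
    - dx 1 3 4 6 a b c d - dx 1 2 5 6 a b c d - dx 1 2 4 7 a b c d

/-- The `G₂` 3-form `φ` of `S⁷` at the point `x`, on vectors tangent to `S⁷` at `x`.  It is given
by `Φ₀ = r³ dr ∧ φ + r⁴ *φ`, so it is the contraction of `Φ₀` with the radial vector `x`. -/
def phi (x : S7) (a b c : E8) : ℝ := Phi (x : E8) a b c

/-- The standard basis of `ℝ⁸`. -/
def stdVec (i : Fin 8) : E8 := EuclideanSpace.single i 1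

/-- The matrix with columns `g 0, …, g 7` belongs to `Spin(7)`, the stabilizer of `Φ₀`
(which is a subgroup of `SO(8)`). -/
structure IsSpin7 (g : Fin 8 → E8) : Prop where
  orthonormal : Orthonormal ℝ g
  phi_eq : ∀ i j k l, Phi (g i) (g j) (g k) (g l)
    = Phi (stdVec i) (stdVec j) (stdVec k) (stdVec l)

/-! ### Extrinsic geometry of a local parametrization

Here `u : ℝ³ → ℝ⁸` is an immersion with values in `S⁷`, defined near the point considered;
tangent vectors of `A` at `u y` are `fderiv ℝ u y v` with `v : ℝ³`. -/

/-- The tangent space of `A` at `u y`, as a subspace of `ℝ⁸`. -/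
def tangentPlane (u : E3 → E8) (y : E3) : Submodule ℝ E8 :=
  LinearMap.range (fderiv ℝ u y).toLinearMap

/-- The normal space of `A` in `S⁷` at `u y`: the vectors of `ℝ⁸` that are orthogonal to the
position vector `u y` (that is, tangent to `S⁷`) and to the tangent space of `A`. -/
def normalSpace (u : E3 → E8) (y : E3) : Submodule ℝ E8 :=
  (Submodule.span ℝ {u y} ⊔ tangentPlane u y)ᗮ

/-- The orthogonal projection of `ℝ⁸` onto the normal space of `A` in `S⁷` at `u y`. -/
def normalProj (u : E3 → E8) (y : E3) : E8 →L[ℝ] E8 := (normalSpace u y).starProjection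

/-- The second fundamental form of `A` in `S⁷`: `II(v, w)` is the normal component of the
derivative in the direction `v` of the tangent field `y ↦ fderiv ℝ u y w`.  (The Levi-Civita
connection of `S⁷` differs from the flat derivative of `ℝ⁸` by a multiple of the position
vector, which `normalProj` removes.) -/
def secondFF (u : E3 → E8) (y : E3) (v w : E3) : E8 :=
  normalProj u y (fderiv ℝ (fun z => fderiv ℝ u z w) y v)

/-- The connection of the normal bundle of `A` in `S⁷`: the covariant derivative of the normal
section `ξ` along the coordinate vector field `v`. -/
def normalDeriv (u : E3 → E8) (v : E3) (ξ : E3 → E8) (y : E3) : E8 :=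
  normalProj u y (fderiv ℝ ξ y v)

/-- The curvature of the normal connection, applied to the normal section `ξ`:
`∇_v ∇_w ξ - ∇_w ∇_v ξ` (the term `∇_[v,w] ξ` is zero as `v`, `w` are coordinate fields). -/
def normalCurvature (u : E3 → E8) (v w : E3) (ξ : E3 → E8) (y : E3) : E8 :=
  normalDeriv u v (normalDeriv u w ξ) y - normalDeriv u w (normalDeriv u v ξ) y

/-! ### Adapted frames and the tensor `R⁻` -/

/-- `g = (x, e₁, e₂, e₃, f₄, f₅, f₆, f₇)` is a smooth adapted frame of `A` over `V`: it takes its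
values in `Spin(7)`, its first column is the position vector, the `e_j` are tangent to `A` and the
`f_a` are normal to `A` in `S⁷`. -/
structure IsAdaptedFrame (u : E3 → E8) (V : Set E3) (g : Fin 8 → E3 → E8) : Prop where
  smooth : ∀ i, ContDiffOn ℝ ∞ (g i) V
  position : ∀ y ∈ V, g 0 y = u y
  tangent : ∀ y ∈ V, ∀ i ∈ ({1, 2, 3} : Set (Fin 8)), g i y ∈ tangentPlane u y
  normal : ∀ y ∈ V, ∀ i ∈ ({4, 5, 6, 7} : Set (Fin 8)), g i y ∈ normalSpace u y
  spin7 : ∀ y ∈ V, IsSpin7 fun i => g i y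

/-- The entry `(a, b)` of the Maurer-Cartan form `g⁻¹ dg = gᵀ dg` of an orthonormal frame. -/
def mcForm (g : Fin 8 → E3 → E8) (a b : Fin 8) (y v : E3) : ℝ :=
  ⟪g a y, fderiv ℝ (g b) y v⟫

/-- The 1-forms `γ₁, γ₂, γ₃`.  The block of `g⁻¹ dg` with indices `4, …, 7`, which is the
connection matrix of the normal bundle, splits into self-dual and anti-self-dual parts
`½[α - ω]₊ + ½[γ]₋`, where
`[(x,y,z)]₊ = (0, -x, -y, z; x, 0, z, y; y, -z, 0, -x; -z, -y, x, 0)` and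
`[(x,y,z)]₋ = (0, -x, -y, -z; x, 0, z, -y; y, -z, 0, x; z, y, -x, 0)`.
This reads off `γ`. -/
def gammaForm (g : Fin 8 → E3 → E8) (y v : E3) : Fin 3 → ℝ :=
  ![mcForm g 5 4 y v - mcForm g 7 6 y v,
    mcForm g 6 4 y v - mcForm g 5 7 y v,
    mcForm g 5 6 y v - mcForm g 4 7 y v]

/-- The skew-symmetric `3 × 3` matrix `[x]` of a vector `x`. -/
def bracket (x : Fin 3 → ℝ) : Matrix (Fin 3) (Fin 3) ℝ :=
  !![0, x 2, -x 1; -x 2, 0, x 0; x 1, -x 0, 0]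

/-- The tensor `R⁻` at the point with parameter `y`: the curvature 2-forms
`½ R⁻_{ijkl} ω_k ∧ ω_l = d[γ]_{ij} + [γ]_{im} ∧ [γ]_{mj}`, evaluated on the tangent
vectors `v`, `w`. -/
def RMinus (g : Fin 8 → E3 → E8) (i j : Fin 3) (y v w : E3) : ℝ :=
  (fderiv ℝ (fun z => bracket (gammaForm g z w) i j) y v
    - fderiv ℝ (fun z => bracket (gammaForm g z v) i j) y w)
  + ∑ m : Fin 3,
      (bracket (gammaForm g y v) i m * bracket (gammaForm g y w) m j
        - bracket (gammaForm g y w) i m * bracket (gammaForm g y v) m j)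

/-! ### Immersed 3-folds in `S⁷` -/

section Immersed

variable {M : Type*} [TopologicalSpace M] [ChartedSpace E3 M]

/-- The differential of `F : M → S⁷` at `p`, as a map from `T_p M` to `ℝ⁸`. -/
def diff (F : M → S7) (p : M) : TangentSpace (𝓡 3) p →L[ℝ] E8 :=
  mfderiv (𝓡 3) 𝓘(ℝ, E8) (fun q => (F q : E8)) p

/-- `F` is a smooth immersion. -/
structure IsSmoothImmersion (F : M → S7) : Prop where
  smooth : ContMDiff (𝓡 3) (𝓡 7) ∞ F
  injective : ∀ p, Function.Injective (mfderiv (𝓡 3) (𝓡 7) F p)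

/-- `A = F(M)`, with the orientation `o`, is associative: `φ|_A = vol_A`, that is, `φ` takes on
every positively oriented basis of every tangent space the value of the volume form of the
induced metric.  (This forces `o` to vary continuously, as `φ|_A` does.) -/
def IsAssociative (F : M → S7) (o : ∀ p : M, Orientation ℝ (TangentSpace (𝓡 3) p) (Fin 3)) :
    Prop :=
  ∀ (p : M) (b : Module.Basis (Fin 3) ℝ (TangentSpace (𝓡 3) p)), b.orientation = o p →
    phi (F p) (diff F p (b 0)) (diff F p (b 1)) (diff F p (b 2))
      = √(Matrix.of fun i j => ⟪diff F p (b i), diff F p (b j)⟫).det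

/-- `F`, written in the preferred chart at `p`. -/
def param (F : M → S7) (p : M) (y : E3) : E8 := (F ((extChartAt (𝓡 3) p).symm y) : E8)

/-- The image of `p` in its preferred chart. -/
def chartPt (p : M) : E3 := extChartAt (𝓡 3) p p

/-- `A` is totally geodesic: its second fundamental form in `S⁷` is zero. -/
def IsTotallyGeodesic (F : M → S7) : Prop :=
  ∀ (p : M) (v w : E3), secondFF (param F p) (chartPt p) v w = 0

/-- The normal bundle of `A` in `S⁷` is flat: at every point, the curvature of the normal
connection is zero on every smooth local normal section. -/
def HasFlatNormalBundle (F : M → S7) : Prop :=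
  ∀ (p : M) (v w : E3) (ξ : E3 → E8), ContDiffAt ℝ ∞ ξ (chartPt p) →
    (∀ᶠ y in 𝓝 (chartPt p), ξ y ∈ normalSpace (param F p) y) →
    normalCurvature (param F p) v w ξ (chartPt p) = 0

/-- The tensor `R⁻` of `A` is zero at every point `p`, when computed in some adapted frame near
`p`.  (Its vanishing at `p` does not depend on the frame: a change of adapted frame rotates `[γ]`
by a gauge transformation, so conjugates the matrix `R⁻`.) -/
def RMinusVanishes (F : M → S7) : Prop :=
  ∀ p : M, ∃ (V : Set E3) (g : Fin 8 → E3 → E8), IsOpen V ∧ chartPt p ∈ V ∧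
    V ⊆ (extChartAt (𝓡 3) p).target ∧ IsAdaptedFrame (param F p) V g ∧
    ∀ (i j : Fin 3) (v w : E3), RMinus g i j (chartPt p) v w = 0

end Immersed

end AssocS7

end

namespace AssocS7

/-! Everything is pointwise linear algebra on the second fundamental form `II`, fed by two sources:
first-order consequences of being calibrated, and the Ricci equation.

The Cayley form has comass one, because it is an inner product of octonion products up to terms that
vanish when the first vector is orthogonal to the others. Hence its first variation at a calibrated
plane is zero: `Phi` vanishes on three vectors of the plane and one normal vector. Differentiating
this along `A` gives II(v, e_c) = e_a × II(v, e_b) - e_b × II(v, e_a) for each cyclic triple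
(`inner_secondFF_of_calibrated`), where × is the cross product defined by `Phi (u y)`.

Flat normal bundle: the Ricci equation says that the tensor ∑_i II(e_i, e_j) ⊗ II(e_i, e_k) is
symmetric, so every skew form sums to zero on it (`sum_skew_eq_zero`). Pairing the relation above
with II(e_i, e_c) and summing over i writes ∑_i |II(e_i, e_c)|² as a difference of two such sums,
hence as zero. The converse is the Ricci equation read backwards. No adapted frame is needed.

Vanishing R⁻: this is only part of flatness, and the argument is subtler. The linear relations cut
the symmetric forms II down to a real 12-dimensional space, which is identified with the complex
binary quintics. The nine components of R⁻ = 0 become six real equations, saying that the quadratic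
covariant of order two vanishes, and three saying that the SU(2) moment map vanishes. The former
force the quintic to be l⁴m with l, m linear (`exists_isFourthPowerMul`). Contracting the latter
with l then gives |l|⁸ times a positive definite expression in m, so the quintic is zero
(`quintic_eq_zero`). -/

/-! ### Binary quintics -/

/-- The coefficients of a binary quintic `∑ (5 choose k) a_k x^(5-k) y^k` of the form `l⁴ m` with
linear forms `l = l₀ x + l₁ y` and `m = m₀ x + m₁ y`. -/
structure IsFourthPowerMul (a0 a1 a2 a3 a4 a5 l0 l1 m0 m1 : ℂ) : Prop where
  c0 : a0 = l0 ^ 4 * m0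
  c1 : 5 * a1 = 4 * l0 ^ 3 * l1 * m0 + l0 ^ 4 * m1
  c2 : 10 * a2 = 6 * l0 ^ 2 * l1 ^ 2 * m0 + 4 * l0 ^ 3 * l1 * m1
  c3 : 10 * a3 = 4 * l0 * l1 ^ 3 * m0 + 6 * l0 ^ 2 * l1 ^ 2 * m1
  c4 : 5 * a4 = l1 ^ 4 * m0 + 4 * l0 * l1 ^ 3 * m1
  c5 : a5 = l1 ^ 4 * m1

/-- A binary quintic whose quadratic covariant of degree two vanishes has a linear factor of
multiplicity at least four. -/
theorem exists_isFourthPowerMul {a0 a1 a2 a3 a4 a5 : ℂ}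
    (h0 : a0 * a4 - 4 * a1 * a3 + 3 * a2 ^ 2 = 0)
    (h1 : a0 * a5 - 3 * a1 * a4 + 2 * a2 * a3 = 0)
    (h2 : a1 * a5 - 4 * a2 * a4 + 3 * a3 ^ 2 = 0) :
    ∃ l0 l1 m0 m1, IsFourthPowerMul a0 a1 a2 a3 a4 a5 l0 l1 m0 m1 := by
  by_cases ha0 : a0 = 0
  · subst ha0
    by_cases ha1 : a1 = 0
    · subst ha1
      have ha2 : a2 = 0 := by simpa using h0
      subst ha2
      have ha3 : a3 = 0 := by simpa using h2
      subst ha3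
      exact ⟨0, 1, 5 * a4, a5, by constructor <;> ring⟩
    -- Here y divides the quintic exactly once, so m = 5 a1 y, and the covariant determines the
    -- other coefficients in turn.
    · obtain ⟨t, rfl⟩ : ∃ t, a2 = a1 * t := ⟨a2 / a1, by field_simp⟩
      have e3 : a3 = a1 * (3 / 4 * t ^ 2) := by
        apply mul_left_cancel₀ ha1; linear_combination -h0 / 4
      subst e3
      have e4 : a4 = a1 * (t ^ 3 / 2) := by
        apply mul_left_cancel₀ ha1; linear_combination -h1 / 3
      subst e4
      have e5 : a5 = a1 * (5 / 16 * t ^ 4) := by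
        apply mul_left_cancel₀ ha1; linear_combination h2
      subst e5
      exact ⟨1, t / 2, 0, 5 * a1, by constructor <;> ring⟩
  · obtain ⟨b1, rfl⟩ : ∃ t, a1 = a0 * t := ⟨a1 / a0, by field_simp⟩
    -- The shift x ↦ x - b1 y removes the x⁴y term; `c2` and `c3` are the next coefficients of the
    -- resulting depressed quintic, divided by `a0`.
    obtain ⟨c2, rfl⟩ : ∃ t, a2 = a0 * (t + b1 ^ 2) := ⟨a2 / a0 - b1 ^ 2, by field_simp; ring⟩
    obtain ⟨c3, rfl⟩ : ∃ t, a3 = a0 * (t + 3 * b1 * c2 + b1 ^ 3) :=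
      ⟨a3 / a0 - 3 * b1 * c2 - b1 ^ 3, by field_simp; ring⟩
    have e4 : a4 = a0 * (4 * b1 * (c3 + 3 * b1 * c2 + b1 ^ 3) - 3 * (c2 + b1 ^ 2) ^ 2) := by
      apply mul_left_cancel₀ ha0; linear_combination h0
    subst e4
    have e5 : a5 = a0 * (3 * b1 * (4 * b1 * (c3 + 3 * b1 * c2 + b1 ^ 3) - 3 * (c2 + b1 ^ 2) ^ 2)
        - 2 * (c2 + b1 ^ 2) * (c3 + 3 * b1 * c2 + b1 ^ 3)) := by
      apply mul_left_cancel₀ ha0; linear_combination h1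
    subst e5
    have e : c3 ^ 2 = -4 * c2 ^ 3 := by
      have h : a0 ^ 2 * (c3 ^ 2 + 4 * c2 ^ 3) = 0 := by linear_combination h2 / 3
      have := (mul_eq_zero.1 h).resolve_left (pow_ne_zero 2 ha0)
      linear_combination this
    -- Rational parametrization of the cuspidal cubic `e`. The depressed quintic is then (x + s y)⁴
    -- (x - 4 s y), and undoing the shift gives the witnesses below.
    obtain ⟨s, rfl, rfl⟩ : ∃ s, c2 = -s ^ 2 ∧ c3 = -2 * s ^ 3 := by
      by_cases hc : c2 = 0
      · subst hc
        have hc3 : c3 = 0 := by simpa using e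
        exact ⟨0, by simp, by simp [hc3]⟩
      · refine ⟨c3 / (2 * c2), ?_, ?_⟩
        · field_simp; linear_combination e
        · field_simp; linear_combination c3 * e
    exact ⟨1, b1 + s, a0, a0 * (b1 - 4 * s), by constructor <;> ring⟩

open ComplexConjugate in
/-- A binary quintic whose quadratic covariant of degree two and whose `SU(2)`-moment map vanish
is zero. -/
theorem quintic_eq_zero {a0 a1 a2 a3 a4 a5 : ℂ}
    (h0 : a0 * a4 - 4 * a1 * a3 + 3 * a2 ^ 2 = 0)
    (h1 : a0 * a5 - 3 * a1 * a4 + 2 * a2 * a3 = 0)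
    (h2 : a1 * a5 - 4 * a2 * a4 + 3 * a3 ^ 2 = 0)
    (hm : a0 * conj a0 + 3 * (a1 * conj a1) + 2 * (a2 * conj a2) - 2 * (a3 * conj a3)
      - 3 * (a4 * conj a4) - a5 * conj a5 = 0)
    (hn : a0 * conj a1 + 4 * (a1 * conj a2) + 6 * (a2 * conj a3) + 4 * (a3 * conj a4)
      + a4 * conj a5 = 0) :
    a0 = 0 ∧ a1 = 0 ∧ a2 = 0 ∧ a3 = 0 ∧ a4 = 0 ∧ a5 = 0 := by
  obtain ⟨l0, l1, m0, m1, c0, c1, c2, c3, c4, c5⟩ := exists_isFourthPowerMul h0 h1 h2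
  replace c1 : a1 = (4 * l0 ^ 3 * l1 * m0 + l0 ^ 4 * m1) / 5 := by linear_combination c1 / 5
  replace c2 : a2 = (6 * l0 ^ 2 * l1 ^ 2 * m0 + 4 * l0 ^ 3 * l1 * m1) / 10 := by
    linear_combination c2 / 10
  replace c3 : a3 = (4 * l0 * l1 ^ 3 * m0 + 6 * l0 ^ 2 * l1 ^ 2 * m1) / 10 := by
    linear_combination c3 / 10
  replace c4 : a4 = (l1 ^ 4 * m0 + 4 * l0 * l1 ^ 3 * m1) / 5 := by linear_combination c4 / 5
  have hn' : conj a0 * a1 + 4 * (conj a1 * a2) + 6 * (conj a2 * a3) + 4 * (conj a3 * a4)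
      + conj a4 * a5 = 0 := by
    have := congrArg conj hn
    simpa only [map_add, map_mul, Complex.conj_conj, map_ofNat, map_zero] using this
  clear h0 h1 h2
  -- The moment map is paired with twice the trace-free part of the Hermitian matrix l l*; on l⁴m
  -- this pairing is |l|⁸ times a positive combination of |l ∧ m|² and |⟨m, l⟩|².
  have key : (l0 * conj l0 + l1 * conj l1) ^ 4 *
      (3 / 25 * ((l0 * m1 - l1 * m0) * conj (l0 * m1 - l1 * m0))
        + (m0 * conj l0 + m1 * conj l1) * conj (m0 * conj l0 + m1 * conj l1)) = 0 := by
    rw [c0, c1, c2, c3, c4, c5] at hm hn hn'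
    simp only [map_mul, map_add, map_sub, map_pow, map_div₀, Complex.conj_conj, map_ofNat]
      at hm hn hn' ⊢
    linear_combination (l0 * conj l0 - l1 * conj l1) * hm + 2 * conj l0 * l1 * hn
      + 2 * l0 * conj l1 * hn'
  have hlm : (l0 = 0 ∧ l1 = 0) ∨ (m0 = 0 ∧ m1 = 0) := by
    simp only [Complex.mul_conj] at key
    norm_cast at key
    have zero_of_add : ∀ x y : ℂ, Complex.normSq x + Complex.normSq y = 0 → x = 0 ∧ y = 0 := by
      intro x y h
      have hx := Complex.normSq_nonneg x
      have hy := Complex.normSq_nonneg y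
      exact ⟨Complex.normSq_eq_zero.1 (by linarith), Complex.normSq_eq_zero.1 (by linarith)⟩
    by_cases hl : l0 = 0 ∧ l1 = 0
    · exact Or.inl hl
    · right
      have h4 : (Complex.normSq l0 + Complex.normSq l1) ≠ 0 := fun h => hl (zero_of_add _ _ h)
      have h5 : 3 / 25 * Complex.normSq (l0 * m1 - l1 * m0)
          + Complex.normSq (m0 * conj l0 + m1 * conj l1) = 0 := by
        have h6 := key
        simp only [Complex.ofReal_add, Complex.ofReal_pow] at h6
        rcases mul_eq_zero.1 h6 with h | h
        · exact absurd (by exact_mod_cast pow_eq_zero_iff (four_ne_zero) |>.1 h) h4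
        · apply Complex.ofReal_injective
          push_cast
          exact_mod_cast h
      have hx := Complex.normSq_nonneg (l0 * m1 - l1 * m0)
      have hy := Complex.normSq_nonneg (m0 * conj l0 + m1 * conj l1)
      have e1 : l0 * m1 - l1 * m0 = 0 := Complex.normSq_eq_zero.1 (by linarith)
      have e2 : m0 * conj l0 + m1 * conj l1 = 0 := Complex.normSq_eq_zero.1 (by linarith)
      have h4' : (l0 * conj l0 + l1 * conj l1) ≠ 0 := by
        rw [Complex.mul_conj, Complex.mul_conj]; exact_mod_cast h4
      -- For l ≠ 0 the equations l ∧ m = 0 and ⟨m, l⟩ = 0 form a linear system in m of determinant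
      -- |l|², up to sign.
      constructor
      · apply (mul_eq_zero.1 (_ : (l0 * conj l0 + l1 * conj l1) * m0 = 0)).resolve_left h4'
        linear_combination l0 * e2 - conj l1 * e1
      · apply (mul_eq_zero.1 (_ : (l0 * conj l0 + l1 * conj l1) * m1 = 0)).resolve_left h4'
        linear_combination l1 * e2 + conj l0 * e1
  rcases hlm with ⟨rfl, rfl⟩ | ⟨rfl, rfl⟩ <;> simp [c0, c1, c2, c3, c4, c5]

/-! ### The second fundamental form as a binary quintic -/

/-- A symmetric form `h` on `ℝ³` with values in `ℝ⁴` that is the second fundamental form of an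
associative 3-fold vanishes if the anti-self-dual part of `∑ c, h v c ∧ h w c` does. -/
theorem eq_zero_of_antiSelfDual_eq_zero (h : Fin 3 → Fin 3 → Fin 4 → ℝ)
    (symm : ∀ v w a, h v w a = h w v a)
    (r0 : ∀ v, h v 0 0 + h v 1 3 + h v 2 2 = 0)
    (r1 : ∀ v, h v 0 1 + h v 1 2 - h v 2 3 = 0)
    (r2 : ∀ v, h v 0 2 - h v 1 1 - h v 2 0 = 0)
    (r3 : ∀ v, h v 0 3 - h v 1 0 + h v 2 1 = 0)
    (R0 : ∀ v w, ∑ c, (h v c 0 * h w c 3 - h v c 1 * h w c 2 + h v c 2 * h w c 1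
      - h v c 3 * h w c 0) = 0)
    (R1 : ∀ v w, ∑ c, (h v c 2 * h w c 0 - h v c 0 * h w c 2 + h v c 3 * h w c 1
      - h v c 1 * h w c 3) = 0)
    (R2 : ∀ v w, ∑ c, (h v c 0 * h w c 1 - h v c 1 * h w c 0 + h v c 3 * h w c 2
      - h v c 2 * h w c 3) = 0)
    (v w : Fin 3) (a : Fin 4) : h v w a = 0 := by
  have s120 := symm 1 0 0
  have s121 := symm 1 0 1
  have s122 := symm 1 0 2
  have s123 := symm 1 0 3
  have s130 := symm 2 0 0
  have s131 := symm 2 0 1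
  have s132 := symm 2 0 2
  have s133 := symm 2 0 3
  have s230 := symm 2 1 0
  have s231 := symm 2 1 1
  have s232 := symm 2 1 2
  have s233 := symm 2 1 3
  have r00 := r0 0
  have r01 := r0 1
  have r02 := r0 2
  have r10 := r1 0
  have r11 := r1 1
  have r12 := r1 2
  have r20 := r2 0
  have r21 := r2 1
  have r22 := r2 2
  have r30 := r3 0
  have r31 := r3 1
  have r32 := r3 2
  -- Twelve real coordinates on the solutions of the symmetry and linear relations: p_k + i q_k are
  -- the coefficients of the quintic. The equations `e114` to `e337` invert this change of
  -- variables.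
  obtain ⟨p0, dp0⟩ : ∃ t, t = h 2 2 0 - h 1 1 0 - 2 * h 1 2 1 := ⟨_, rfl⟩
  obtain ⟨p1, dp1⟩ : ∃ t, t = h 0 2 0 - h 0 1 1 := ⟨_, rfl⟩
  obtain ⟨p2, dp2⟩ : ∃ t, t = h 0 0 0 := ⟨_, rfl⟩
  obtain ⟨p3, dp3⟩ : ∃ t, t = -h 0 0 2 := ⟨_, rfl⟩
  obtain ⟨p4, dp4⟩ : ∃ t, t = h 2 2 0 - h 1 1 0 + 2 * h 1 2 1 := ⟨_, rfl⟩
  obtain ⟨p5, dp5⟩ : ∃ t, t = h 1 1 2 - h 2 2 2 + 2 * h 1 2 3 := ⟨_, rfl⟩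
  obtain ⟨q0, dq0⟩ : ∃ t, t = h 2 2 1 - h 1 1 1 + 2 * h 1 2 0 := ⟨_, rfl⟩
  obtain ⟨q1, dq1⟩ : ∃ t, t = h 0 2 1 + h 0 1 0 := ⟨_, rfl⟩
  obtain ⟨q2, dq2⟩ : ∃ t, t = h 0 0 1 := ⟨_, rfl⟩
  obtain ⟨q3, dq3⟩ : ∃ t, t = h 0 0 3 := ⟨_, rfl⟩
  obtain ⟨q4, dq4⟩ : ∃ t, t = h 2 2 1 - h 1 1 1 - 2 * h 1 2 0 := ⟨_, rfl⟩
  obtain ⟨q5, dq5⟩ : ∃ t, t = h 2 2 3 - h 1 1 3 + 2 * h 1 2 2 := ⟨_, rfl⟩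
  have e114 : h 0 0 0 = p2 := by
    linear_combination (-1) * dp2
  have e115 : h 0 0 1 = q2 := by
    linear_combination (-1) * dq2
  have e116 : h 0 0 2 = (-1) * p3 := by
    linear_combination dp3
  have e117 : h 0 0 3 = q3 := by
    linear_combination (-1) * dq3
  have e124 : h 0 1 0 = (1/2) * q1 + (1/2) * q3 := by
    linear_combination (-1/2) * r30 + (-1/2) * dq1 + (-1/2) * dq3
  have e125 : h 0 1 1 = (-1/2) * p1 + (-1/2) * p3 := by
    linear_combination (-1/2) * r20 + (1/2) * dp1 + (1/2) * dp3
  have e126 : h 0 1 2 = (-1/2) * q2 + (-1/2) * q4 := by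
        linear_combination (-1/2) * s122 + (-1/2) * s133 + (1/2) * s230 + (1/2) * r10 + (1/2) *
      r21 + (1/2) * r32 + (1/2) * dq2 + (1/2) * dq4
  have e127 : h 0 1 3 = (-1/2) * p2 + (-1/2) * p4 := by
        linear_combination (-1/2) * s123 + (1/2) * s132 + (-1/2) * s231 + (1/2) * r00 + (1/2) *
      r31 + (-1/2) * r22 + (1/2) * dp2 + (1/2) * dp4
  have e134 : h 0 2 0 = (1/2) * p1 + (-1/2) * p3 := by
    linear_combination (-1/2) * r20 + (-1/2) * dp1 + (1/2) * dp3
  have e135 : h 0 2 1 = (1/2) * q1 + (-1/2) * q3 := by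
    linear_combination (1/2) * r30 + (-1/2) * dq1 + (1/2) * dq3
  have e136 : h 0 2 2 = (-1/2) * p2 + (1/2) * p4 := by
        linear_combination (1/2) * s123 + (-1/2) * s132 + (1/2) * s231 + (1/2) * r00 + (-1/2) *
      r31 + (1/2) * r22 + (1/2) * dp2 + (-1/2) * dp4
  have e137 : h 0 2 3 = (1/2) * q2 + (-1/2) * q4 := by
        linear_combination (-1/2) * s122 + (-1/2) * s133 + (1/2) * s230 + (-1/2) * r10 + (1/2) *
      r21 + (1/2) * r32 + (-1/2) * dq2 + (1/2) * dq4
  have e224 : h 1 1 0 = (-1/4) * p0 + (-1/2) * p2 + (-1/4) * p4 := by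
        linear_combination (1/2) * s123 + (1/2) * s132 + (-1/2) * s231 + (1/2) * r00 + (-1/2) *
      r31 + (-1/2) * r22 + (1/4) * dp0 + (1/2) * dp2 + (1/4) * dp4
  have e225 : h 1 1 1 = (-1/4) * q0 + (-1/2) * q2 + (-1/4) * q4 := by
        linear_combination (1/2) * s122 + (-1/2) * s133 + (1/2) * s230 + (1/2) * r10 + (-1/2) *
      r21 + (1/2) * r32 + (1/4) * dq0 + (1/2) * dq2 + (1/4) * dq4
  have e226 : h 1 1 2 = (1/4) * p1 + (1/2) * p3 + (1/4) * p5 := by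
        linear_combination (-3/4) * s121 + (-1/4) * s130 + (-1/4) * s233 + (1/2) * r20 + (3/4) *
      r11 + (1/4) * r02 + (-1/4) * dp1 + (-1/2) * dp3 + (-1/4) * dp5
  have e227 : h 1 1 3 = (-1/4) * q1 + (-1/2) * q3 + (-1/4) * q5 := by
        linear_combination (-3/4) * s120 + (1/4) * s131 + (1/4) * s232 + (1/2) * r30 + (3/4) * r01
      + (-1/4) * r12 + (1/4) * dq1 + (1/2) * dq3 + (1/4) * dq5
  have e234 : h 1 2 0 = (1/4) * q0 + (-1/4) * q4 := by
    linear_combination (-1/4) * dq0 + (1/4) * dq4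
  have e235 : h 1 2 1 = (-1/4) * p0 + (1/4) * p4 := by
    linear_combination (1/4) * dp0 + (-1/4) * dp4
  have e236 : h 1 2 2 = (-1/4) * q1 + (1/4) * q5 := by
        linear_combination (-1/4) * s120 + (-1/4) * s131 + (-1/4) * s232 + (1/4) * r01 + (1/4) *
      r12 + (1/4) * dq1 + (-1/4) * dq5
  have e237 : h 1 2 3 = (-1/4) * p1 + (1/4) * p5 := by
        linear_combination (1/4) * s121 + (-1/4) * s130 + (-1/4) * s233 + (-1/4) * r11 + (1/4) *
      r02 + (1/4) * dp1 + (-1/4) * dp5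
  have e334 : h 2 2 0 = (1/4) * p0 + (-1/2) * p2 + (1/4) * p4 := by
        linear_combination (1/2) * s123 + (1/2) * s132 + (-1/2) * s231 + (1/2) * r00 + (-1/2) *
      r31 + (-1/2) * r22 + (-1/4) * dp0 + (1/2) * dp2 + (-1/4) * dp4
  have e335 : h 2 2 1 = (1/4) * q0 + (-1/2) * q2 + (1/4) * q4 := by
        linear_combination (1/2) * s122 + (-1/2) * s133 + (1/2) * s230 + (1/2) * r10 + (-1/2) *
      r21 + (1/2) * r32 + (-1/4) * dq0 + (1/2) * dq2 + (-1/4) * dq4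
  have e336 : h 2 2 2 = (-1/4) * p1 + (1/2) * p3 + (-1/4) * p5 := by
        linear_combination (-1/4) * s121 + (-3/4) * s130 + (-3/4) * s233 + (1/2) * r20 + (1/4) *
      r11 + (3/4) * r02 + (1/4) * dp1 + (-1/2) * dp3 + (1/4) * dp5
  have e337 : h 2 2 3 = (1/4) * q1 + (-1/2) * q3 + (1/4) * q5 := by
        linear_combination (-1/4) * s120 + (3/4) * s131 + (3/4) * s232 + (1/2) * r30 + (1/4) * r01
      + (-3/4) * r12 + (-1/4) * dq1 + (1/2) * dq3 + (-1/4) * dq5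
  have a01 := R0 0 1
  have a02 := R0 0 2
  have a12 := R0 1 2
  have b01 := R1 0 1
  have b02 := R1 0 2
  have b12 := R1 1 2
  have c01 := R2 0 1
  have c02 := R2 0 2
  have c12 := R2 1 2
  simp only [Fin.sum_univ_three, s120, s121, s122, s123, s130, s131, s132, s133, s230, s231, s232, s233,
    e114, e115, e116, e117, e124, e125, e126, e127, e134, e135, e136, e137, e224, e225, e226, e227, e234, e235, e236, e237, e334, e335, e336, e337] at a01 a02 a12 b01 b02 b12 c01 c02 c12
  -- `R0` and `R1` supply the real and imaginary parts of the covariant; `R2` supplies the moment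
  -- map.
  obtain ⟨z0, z1, z2, z3, z4, z5⟩ := quintic_eq_zero
    (a0 := ⟨p0, q0⟩) (a1 := ⟨p1, q1⟩) (a2 := ⟨p2, q2⟩) (a3 := ⟨p3, q3⟩) (a4 := ⟨p4, q4⟩)
    (a5 := ⟨p5, q5⟩)
    (by
      apply Complex.ext <;> simp [pow_two]
      · linear_combination -2 * a01 + 2 * b02
      · linear_combination 2 * b01 + 2 * a02)
    (by
      apply Complex.ext <;> simp
      · linear_combination -4 * a12
      · linear_combination 4 * b12)
    (by
      apply Complex.ext <;> simp [pow_two]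
      · linear_combination 2 * a01 + 2 * b02
      · linear_combination -2 * b01 + 2 * a02)
    (by
      apply Complex.ext <;> simp
      · linear_combination 8 * c12
      · ring)
    (by
      apply Complex.ext <;> simp
      · linear_combination -4 * c01
      · linear_combination 4 * c02)
  obtain ⟨zp0, zq0⟩ := Complex.ext_iff.1 z0
  obtain ⟨zp1, zq1⟩ := Complex.ext_iff.1 z1
  obtain ⟨zp2, zq2⟩ := Complex.ext_iff.1 z2
  obtain ⟨zp3, zq3⟩ := Complex.ext_iff.1 z3
  obtain ⟨zp4, zq4⟩ := Complex.ext_iff.1 z4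
  obtain ⟨zp5, zq5⟩ := Complex.ext_iff.1 z5
  simp only [Complex.zero_re, Complex.zero_im] at zp0 zq0 zp1 zq1 zp2 zq2 zp3 zq3 zp4 zq4 zp5 zq5
  subst zp0 zq0 zp1 zq1 zp2 zq2 zp3 zq3 zp4 zq4 zp5 zq5
  fin_cases v <;> fin_cases w <;> fin_cases a <;>
    simp [s120, s121, s122, s123, s130, s131, s132, s133, s230, s231, s232, s233, e114, e115, e116, e117, e124, e125, e126, e127, e134, e135, e136, e137, e224, e225, e226, e227, e234, e235, e236, e237, e334, e335, e336, e337]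

/-! ### The Cayley form as an alternating map -/

/-- The coordinates with indices `s 0, …, s 3` of a vector of `ℝ⁸`. -/
noncomputable def coordMap (s : Fin 4 → Fin 8) : E8 →ₗ[ℝ] Fin 4 → ℝ :=
  LinearMap.pi fun m => (EuclideanSpace.proj (s m) : E8 →L[ℝ] ℝ).toLinearMap

/-- The form `dx_i ∧ dx_j ∧ dx_k ∧ dx_l` as an alternating map. -/
noncomputable def dxAlt (i j k l : Fin 8) : E8 [⋀^Fin 4]→ₗ[ℝ] ℝ :=
  Matrix.detRowAlternating.compLinearMap (coordMap ![i, j, k, l])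

theorem dxAlt_apply (i j k l : Fin 8) (v : Fin 4 → E8) :
    dxAlt i j k l v = dx i j k l (v 0) (v 1) (v 2) (v 3) := by
  change Matrix.det (fun n => coordMap ![i, j, k, l] (v n)) = _
  rw [dx, ← Matrix.det_transpose]
  congr 1
  ext m n
  fin_cases m <;> fin_cases n <;> rfl

/-- The Cayley form as an alternating map. -/
noncomputable def phiAlt : E8 [⋀^Fin 4]→ₗ[ℝ] ℝ :=
  dxAlt 0 1 2 3 + dxAlt 0 1 4 5 + dxAlt 0 1 6 7 + dxAlt 0 2 4 6
    - dxAlt 0 2 5 7 - dxAlt 0 3 4 7 - dxAlt 0 3 5 6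
    + dxAlt 4 5 6 7 + dxAlt 2 3 6 7 + dxAlt 2 3 4 5 + dxAlt 1 3 5 7
    - dxAlt 1 3 4 6 - dxAlt 1 2 5 6 - dxAlt 1 2 4 7

theorem phiAlt_apply (v : Fin 4 → E8) : phiAlt v = Phi (v 0) (v 1) (v 2) (v 3) := by
  simp only [phiAlt, Phi, AlternatingMap.add_apply, AlternatingMap.sub_apply, dxAlt_apply]

theorem phiAlt_vec (a b c d : E8) : phiAlt ![a, b, c, d] = Phi a b c d := phiAlt_apply _

/-- The Cayley form as a continuous multilinear map. -/
noncomputable def phiCont : ContinuousMultilinearMap ℝ (fun _ : Fin 4 => E8) ℝ where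
  toMultilinearMap := phiAlt.toMultilinearMap
  cont := by
    change Continuous fun v => phiAlt v
    simp only [phiAlt_apply, Phi, dx]
    have h : ∀ i j k l : Fin 8, Continuous fun v : Fin 4 → E8 =>
        Matrix.det !![v 0 i, v 1 i, v 2 i, v 3 i; v 0 j, v 1 j, v 2 j, v 3 j;
          v 0 k, v 1 k, v 2 k, v 3 k; v 0 l, v 1 l, v 2 l, v 3 l] := by
      intro i j k l
      apply Continuous.matrix_det
      refine continuous_matrix fun m n => ?_
      fin_cases m <;> fin_cases n <;> simp <;> fun_prop
    fun_prop (disch := assumption)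

theorem phiCont_apply (v : Fin 4 → E8) : phiCont v = Phi (v 0) (v 1) (v 2) (v 3) :=
  phiAlt_apply v

/-- The product rule for the Cayley form. -/
theorem fderiv_Phi {A B C D : E3 → E8} {y : E3} (hA : DifferentiableAt ℝ A y)
    (hB : DifferentiableAt ℝ B y) (hC : DifferentiableAt ℝ C y) (hD : DifferentiableAt ℝ D y)
    (v : E3) :
    fderiv ℝ (fun z => Phi (A z) (B z) (C z) (D z)) y v
      = Phi (fderiv ℝ A y v) (B y) (C y) (D y) + Phi (A y) (fderiv ℝ B y v) (C y) (D y)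
        + Phi (A y) (B y) (fderiv ℝ C y v) (D y) + Phi (A y) (B y) (C y) (fderiv ℝ D y v) := by
  have h : ∀ i : Fin 4, HasFDerivAt ((![A, B, C, D] : Fin 4 → E3 → E8) i)
      ((![fderiv ℝ A y, fderiv ℝ B y, fderiv ℝ C y, fderiv ℝ D y] : Fin 4 → E3 →L[ℝ] E8) i) y := by
    intro i
    fin_cases i
    exacts [hA.hasFDerivAt, hB.hasFDerivAt, hC.hasFDerivAt, hD.hasFDerivAt]
  have := HasFDerivAt.multilinear_comp phiCont h
  have e : (fun z => Phi (A z) (B z) (C z) (D z))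
      = fun z => phiCont fun i => (![A, B, C, D] : Fin 4 → E3 → E8) i z := by
    funext z
    rw [phiCont_apply]; rfl
  rw [e, this.fderiv]
  simp [Fin.sum_univ_four, phiCont_apply, ContinuousMultilinearMap.toContinuousLinearMap]

/-! ### The comass inequality -/

/-- Octonion multiplication `b̄ c`. -/
noncomputable def octMul (b c : E8) : E8 := !₂[
  b 0 * c 0 + b 1 * c 1 + b 2 * c 2 + b 3 * c 3 + b 4 * c 4 + b 5 * c 5 + b 6 * c 6 + b 7 * c 7,
  b 0 * c 1 - b 1 * c 0 + b 2 * c 3 - b 3 * c 2 + b 4 * c 5 - b 5 * c 4 + b 6 * c 7 - b 7 * c 6,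
  b 0 * c 2 - b 1 * c 3 - b 2 * c 0 + b 3 * c 1 + b 4 * c 6 - b 5 * c 7 - b 6 * c 4 + b 7 * c 5,
  b 0 * c 3 + b 1 * c 2 - b 2 * c 1 - b 3 * c 0 - b 4 * c 7 - b 5 * c 6 + b 6 * c 5 + b 7 * c 4,
  b 0 * c 4 - b 1 * c 5 - b 2 * c 6 + b 3 * c 7 - b 4 * c 0 + b 5 * c 1 + b 6 * c 2 - b 7 * c 3,
  b 0 * c 5 + b 1 * c 4 + b 2 * c 7 + b 3 * c 6 - b 4 * c 1 - b 5 * c 0 - b 6 * c 3 - b 7 * c 2,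
  b 0 * c 6 - b 1 * c 7 + b 2 * c 4 - b 3 * c 5 - b 4 * c 2 + b 5 * c 3 - b 6 * c 0 + b 7 * c 1,
  b 0 * c 7 + b 1 * c 6 - b 2 * c 5 - b 3 * c 4 + b 4 * c 3 + b 5 * c 2 - b 6 * c 1 - b 7 * c 0]

theorem inner_eq_sum (a b : E8) : ⟪a, b⟫ = a 0 * b 0 + a 1 * b 1 + a 2 * b 2 + a 3 * b 3
    + a 4 * b 4 + a 5 * b 5 + a 6 * b 6 + a 7 * b 7 := by
  simp [PiLp.inner_apply, Fin.sum_univ_eight, mul_comm]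

/-- The octonions are a normed algebra; in coordinates this is an eight-square identity. -/
theorem norm_octMul (b c : E8) : ‖octMul b c‖ = ‖b‖ * ‖c‖ := by
  rw [← sq_eq_sq₀ (norm_nonneg _) (by positivity), mul_pow]
  simp only [← real_inner_self_eq_norm_sq, inner_eq_sum]
  simp [octMul]
  ring

theorem det_four (M : Matrix (Fin 4) (Fin 4) ℝ) : M.det =
    M 0 0 * (M 1 1 * (M 2 2 * M 3 3 - M 2 3 * M 3 2) - M 1 2 * (M 2 1 * M 3 3 - M 2 3 * M 3 1)
        + M 1 3 * (M 2 1 * M 3 2 - M 2 2 * M 3 1))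
      - M 0 1 * (M 1 0 * (M 2 2 * M 3 3 - M 2 3 * M 3 2) - M 1 2 * (M 2 0 * M 3 3 - M 2 3 * M 3 0)
        + M 1 3 * (M 2 0 * M 3 2 - M 2 2 * M 3 0))
      + M 0 2 * (M 1 0 * (M 2 1 * M 3 3 - M 2 3 * M 3 1) - M 1 1 * (M 2 0 * M 3 3 - M 2 3 * M 3 0)
        + M 1 3 * (M 2 0 * M 3 1 - M 2 1 * M 3 0))
      - M 0 3 * (M 1 0 * (M 2 1 * M 3 2 - M 2 2 * M 3 1) - M 1 1 * (M 2 0 * M 3 2 - M 2 2 * M 3 0)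
        + M 1 2 * (M 2 0 * M 3 1 - M 2 1 * M 3 0)) := by
  simp [Matrix.det_succ_row_zero, Fin.sum_univ_succ, Fin.succAbove]
  ring

theorem dx_eq (i j k l : Fin 8) (a b c d : E8) : dx i j k l a b c d =
    a i * (b j * (c k * d l - d k * c l) - c j * (b k * d l - d k * b l)
        + d j * (b k * c l - c k * b l))
      - b i * (a j * (c k * d l - d k * c l) - c j * (a k * d l - d k * a l)
        + d j * (a k * c l - c k * a l))
      + c i * (a j * (b k * d l - d k * b l) - b j * (a k * d l - d k * a l)
        + d j * (a k * b l - b k * a l))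
      - d i * (a j * (b k * c l - c k * b l) - b j * (a k * c l - c k * a l)
        + c j * (a k * b l - b k * a l)) := by
  rw [dx, det_four]
  rfl

/-- This polynomial identity reduces the comass bound to the Cauchy-Schwarz inequality and
multiplicativity of the octonion norm. -/
theorem Phi_eq_inner_octMul (a b c d : E8) : Phi a b c d =
    ⟪octMul b c, octMul a d⟫ - ⟪a, b⟫ * ⟪c, d⟫ + ⟪a, c⟫ * ⟪b, d⟫ - ⟪a, d⟫ * ⟪b, c⟫ := by
  simp only [inner_eq_sum, Phi, dx_eq]
  simp [octMul]
  ring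

/-- The Cayley form has comass at most one. -/
theorem Phi_le_norm {a b c d : E8} (hab : ⟪a, b⟫ = 0) (hac : ⟪a, c⟫ = 0) (had : ⟪a, d⟫ = 0) :
    Phi a b c d ≤ ‖a‖ * ‖b‖ * ‖c‖ * ‖d‖ := by
  rw [Phi_eq_inner_octMul, hab, hac, had]
  have := real_inner_le_norm (octMul b c) (octMul a d)
  rw [norm_octMul, norm_octMul] at this
  linarith

theorem Phi_add₂ (a b b' c d : E8) : Phi a (b + b') c d = Phi a b c d + Phi a b' c d := by
  simp only [Phi, dx_eq, PiLp.add_apply]; ring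

theorem Phi_add₃ (a b c c' d : E8) : Phi a b (c + c') d = Phi a b c d + Phi a b c' d := by
  simp only [Phi, dx_eq, PiLp.add_apply]; ring

theorem Phi_add₄ (a b c d d' : E8) : Phi a b c (d + d') = Phi a b c d + Phi a b c d' := by
  simp only [Phi, dx_eq, PiLp.add_apply]; ring

theorem Phi_smul₄ (a b c d : E8) (t : ℝ) : Phi a b c (t • d) = t * Phi a b c d := by
  simp only [Phi, dx_eq, PiLp.smul_apply, smul_eq_mul]; ring

theorem Phi_cycle (a b c d : E8) : Phi d a b c = -Phi a b c d := by
  simp only [Phi, dx_eq]; ring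

theorem Phi_neg_of_swap₂₃ (a b c d : E8) : Phi a c b d = -Phi a b c d := by
  simp only [Phi, dx_eq]; ring

theorem Phi_neg_of_swap₃₄ (a b c d : E8) : Phi a b d c = -Phi a b c d := by
  simp only [Phi, dx_eq]; ring

/-- The first variation of the comass inequality. -/
theorem Phi_eq_zero_of_calibrated {a b c d n : E8} (ha : ‖a‖ = 1) (hb : ‖b‖ = 1) (hc : ‖c‖ = 1)
    (hd : ‖d‖ = 1) (hab : ⟪a, b⟫ = 0) (hac : ⟪a, c⟫ = 0) (had : ⟪a, d⟫ = 0)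
    (han : ⟪a, n⟫ = 0) (hdn : ⟪d, n⟫ = 0) (h : Phi a b c d ^ 2 = 1) : Phi a b c n = 0 := by
  set α := Phi a b c d with hα
  set β := Phi a b c n with hβ
  -- The comass bound on α d + t n, where α² = 1. The left side has slope β at t = 0, whereas the
  -- right side is √(1 + t²|n|²), with slope zero.
  have key : ∀ t : ℝ, 1 + t * β ≤ ‖α • d + t • n‖ := by
    intro t
    have := Phi_le_norm hab hac (d := α • d + t • n)
      (by simp [inner_add_right, inner_smul_right, had, han])
    rw [ha, hb, hc, Phi_add₄, Phi_smul₄, Phi_smul₄, ← hα, ← hβ] at this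
    nlinarith
  have hsq : ∀ t : ℝ, ‖α • d + t • n‖ ^ 2 = 1 + t ^ 2 * ‖n‖ ^ 2 := by
    intro t
    rw [norm_add_sq_real, norm_smul, norm_smul, hd, inner_smul_left, inner_smul_right, hdn,
      mul_pow, mul_pow, Real.norm_eq_abs, Real.norm_eq_abs, sq_abs, sq_abs, h]
    simp
  have hK : 0 < ‖n‖ ^ 2 + 1 := by positivity
  -- For this t = s the squared inequality becomes s² (|n|² + 2) ≤ 0.
  have h1 := key (β / (‖n‖ ^ 2 + 1))
  have h2 := hsq (β / (‖n‖ ^ 2 + 1))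
  have h3 : 0 ≤ β / (‖n‖ ^ 2 + 1) * β := by
    rw [div_mul_eq_mul_div]; exact div_nonneg (mul_self_nonneg _) hK.le
  have h4 : (1 + β / (‖n‖ ^ 2 + 1) * β) ^ 2 ≤ 1 + (β / (‖n‖ ^ 2 + 1)) ^ 2 * ‖n‖ ^ 2 := by
    rw [← h2]; gcongr
  have h5 : 2 * (β / (‖n‖ ^ 2 + 1) * β) ≤ (β / (‖n‖ ^ 2 + 1)) ^ 2 * ‖n‖ ^ 2 := by
    nlinarith [sq_nonneg (β / (‖n‖ ^ 2 + 1) * β)]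
  obtain ⟨s, hs⟩ : ∃ s, s = β / (‖n‖ ^ 2 + 1) := ⟨_, rfl⟩
  have hs' : β = s * (‖n‖ ^ 2 + 1) := by rw [hs]; field_simp
  rw [← hs, hs'] at h5
  have h6 : s ^ 2 * (‖n‖ ^ 2 + 2) ≤ 0 := by nlinarith
  have h7 : s = 0 := by
    have : 0 ≤ s ^ 2 * ‖n‖ ^ 2 := by positivity
    have h8 : s ^ 2 ≤ 0 := by nlinarith
    exact pow_eq_zero_iff two_ne_zero |>.1 (le_antisymm h8 (sq_nonneg _))
  rw [hs', h7, zero_mul]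

/-- The Cayley form vanishes on three vectors of a Cayley plane and a vector orthogonal to it. -/
theorem Phi_eq_zero_of_mem_span {w : Fin 4 → E8} (hw : Orthonormal ℝ w) (h : phiAlt w ^ 2 = 1)
    {x y z n : E8} (hx : x ∈ Submodule.span ℝ (Set.range w))
    (hy : y ∈ Submodule.span ℝ (Set.range w)) (hz : z ∈ Submodule.span ℝ (Set.range w))
    (hn : ∀ i, ⟪w i, n⟫ = 0) : Phi x y z n = 0 := by
  -- An alternating map is determined by its values on distinct basis vectors. Three distinct
  -- indices extend to a permutation of all four, which reduces the claim to the first variation,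
  -- the sign disappearing in the square.
  have key : (phiAlt.curryLeft n).compLinearMap (Submodule.span ℝ (Set.range w)).subtype = 0 := by
    refine Module.Basis.ext_alternating (Module.Basis.span hw.linearIndependent) fun v hv => ?_
    obtain ⟨σ, hσ⟩ := Equiv.Perm.exists_extending_pair Fin.castSucc v
      (Fin.castSucc_injective 3) hv
    have hP : Phi (w (σ 0)) (w (σ 1)) (w (σ 2)) (w (σ 3)) ^ 2 = 1 := by
      have := phiAlt.map_perm w σ
      rw [phiAlt_apply] at this
      simp only [Function.comp_apply] at this
      rw [this]
      rcases Int.units_eq_one_or (Equiv.Perm.sign σ) with e | e <;> simp [e, h]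
    have hne : ∀ {i j : Fin 4}, i ≠ j → ⟪w (σ i), w (σ j)⟫ = 0 :=
      fun hij => hw.2 (σ.injective.ne hij)
    have h0 := Phi_eq_zero_of_calibrated (hw.1 _) (hw.1 _) (hw.1 _) (hw.1 _)
      (hne (by decide)) (hne (by decide)) (hne (by decide)) (hn _) (hn _) hP
    have e0 : σ 0 = v 0 := hσ 0
    have e1 : σ 1 = v 1 := hσ 1
    have e2 : σ 2 = v 2 := hσ 2
    rw [e0, e1, e2] at h0
    have : phiAlt ![n, w (v 0), w (v 1), w (v 2)] = 0 := by
      rw [phiAlt_vec, Phi_cycle, h0, neg_zero]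
    simp only [AlternatingMap.compLinearMap_apply, AlternatingMap.curryLeft_apply_apply,
      AlternatingMap.zero_apply]
    convert this using 2
    funext i
    fin_cases i <;> simp [Module.Basis.span_apply]
  have h1 := congrArg (fun f => f ![⟨x, hx⟩, ⟨y, hy⟩, ⟨z, hz⟩]) key
  simp only [AlternatingMap.compLinearMap_apply, AlternatingMap.curryLeft_apply_apply,
    AlternatingMap.zero_apply] at h1
  have h2 : phiAlt ![n, x, y, z] = 0 := by
    rw [← h1]
    congr 1
    funext i
    fin_cases i <;> rfl
  rw [phiAlt_vec, Phi_cycle] at h2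
  linarith

/-! ### Spin(7) frames -/

theorem IsSpin7.phiAlt_comp {g : Fin 8 → E8} (hg : IsSpin7 g) (m : Fin 4 → Fin 8) :
    phiAlt (g ∘ m) = phiAlt (stdVec ∘ m) := by
  rw [phiAlt_apply, phiAlt_apply]
  exact hg.phi_eq _ _ _ _

/-- By multilinearity, invariance on frame vectors extends to one arbitrary slot; this turns the
derivative of the invariance into an equation on the Maurer-Cartan form. -/
theorem IsSpin7.phiAlt_update {g : Fin 8 → E8} (hg : IsSpin7 g) (m : Fin 4 → Fin 8) (i : Fin 4)
    (c : Fin 8 → ℝ) :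
    phiAlt (Function.update (g ∘ m) i (∑ k, c k • g k))
      = phiAlt (Function.update (stdVec ∘ m) i (WithLp.toLp 2 c)) := by
  have e : (WithLp.toLp 2 c : E8) = ∑ k, c k • stdVec k := by
    ext j
    simp [stdVec, Finset.sum_apply, Pi.single_apply]
  rw [e, AlternatingMap.map_update_sum, AlternatingMap.map_update_sum]
  refine Finset.sum_congr rfl fun k _ => ?_
  rw [AlternatingMap.map_update_smul, AlternatingMap.map_update_smul, ← Function.comp_update,
    ← Function.comp_update, hg.phiAlt_comp]

/-- The elements `κ` of the Lie algebra of `Spin(7)` with `κ 0 a = 0` for `a ≥ 4`. -/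
theorem spin7_relations {κ : Fin 8 → Fin 8 → ℝ} (skew : ∀ a b, κ a b = -κ b a)
    (h4 : κ 0 4 = 0) (h5 : κ 0 5 = 0) (h6 : κ 0 6 = 0) (h7 : κ 0 7 = 0)
    (h : ∀ m : Fin 4 → Fin 8, ∑ i, phiAlt (Function.update (stdVec ∘ m) i
      (WithLp.toLp 2 fun k => κ k (m i))) = 0) :
    κ 1 4 + κ 2 7 + κ 3 6 = 0 ∧ κ 1 5 + κ 2 6 - κ 3 7 = 0 ∧ κ 1 6 - κ 2 5 - κ 3 4 = 0 ∧
      κ 1 7 - κ 2 4 + κ 3 5 = 0 := by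
  have s := fun b a => skew a b
  -- Infinitesimal invariance of the Cayley form on the quadruples (0, 1, 2, a), a = 4, …, 7,
  -- already contains the four relations.
  have k4 := h ![0, 1, 2, 4]
  have k5 := h ![0, 1, 2, 5]
  have k6 := h ![0, 1, 2, 6]
  have k7 := h ![0, 1, 2, 7]
  simp [Fin.sum_univ_four, phiAlt_apply, Phi, dx_eq, stdVec, Function.update_apply] at k4 k5 k6 k7
  rw [s 0 4, s 0 5, s 0 6, s 0 7] at *
  refine ⟨?_, ?_, ?_, ?_⟩ <;> linarith [s 1 4, s 1 5, s 1 6, s 1 7, s 2 4, s 2 5, s 2 6, s 2 7]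

/-! ### Local geometry of an immersion into the sphere -/

/-- `u` is a smooth immersion of the open set `V` into the unit sphere. -/
structure IsSphereImmersionOn (u : E3 → E8) (V : Set E3) : Prop where
  isOpen : IsOpen V
  smooth : ContDiffOn ℝ ∞ u V
  norm_eq : ∀ y ∈ V, ‖u y‖ = 1
  injective : ∀ y ∈ V, Function.Injective (fderiv ℝ u y)

theorem mem_normalSpace_iff {u : E3 → E8} {y : E3} {n : E8} :
    n ∈ normalSpace u y ↔ ⟪u y, n⟫ = 0 ∧ ∀ v, ⟪fderiv ℝ u y v, n⟫ = 0 := by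
  rw [normalSpace, ← Submodule.inf_orthogonal, Submodule.mem_inf,
    Submodule.mem_orthogonal_singleton_iff_inner_right, Submodule.mem_orthogonal]
  refine and_congr_right fun _ => ⟨fun h v => h _ ⟨v, rfl⟩, ?_⟩
  rintro h _ ⟨v, rfl⟩
  exact h v

theorem normalProj_mem (u : E3 → E8) (y : E3) (x : E8) : normalProj u y x ∈ normalSpace u y :=
  Submodule.starProjection_apply_mem _ _

theorem normalProj_eq_self {u : E3 → E8} {y : E3} {n : E8} (h : n ∈ normalSpace u y) :
    normalProj u y n = n :=
  Submodule.starProjection_eq_self_iff.2 h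

theorem inner_normalProj_left (u : E3 → E8) (y : E3) (x x' : E8) :
    ⟪normalProj u y x, x'⟫ = ⟪x, normalProj u y x'⟫ :=
  Submodule.inner_starProjection_left_eq_right _ _ _

theorem inner_normalProj_of_mem {u : E3 → E8} {y : E3} {n : E8} (h : n ∈ normalSpace u y)
    (x : E8) : ⟪normalProj u y x, n⟫ = ⟪x, n⟫ := by
  rw [inner_normalProj_left, normalProj_eq_self h]

/-- The Gram operator of an injective map is invertible. -/
theorem isInvertible_adjoint_comp {D : E3 →L[ℝ] E8} (hD : Function.Injective D) :
    (D.adjoint ∘L D).IsInvertible := by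
  have hinj : Function.Injective (D.adjoint ∘L D).toLinearMap := by
    rw [← LinearMap.ker_eq_bot, LinearMap.ker_eq_bot']
    intro v hv
    have h : ⟪D v, D v⟫ = 0 := by
      rw [← ContinuousLinearMap.adjoint_inner_right]
      change ⟪v, (D.adjoint ∘L D).toLinearMap v⟫ = 0
      rw [hv, inner_zero_right]
    exact hD (by rw [inner_self_eq_zero.1 h, map_zero])
  exact ⟨(LinearEquiv.ofInjectiveEndo _ hinj).toContinuousLinearEquiv, by ext; rfl⟩

theorem contDiff_adjoint : ContDiff ℝ ∞ fun D : E3 →L[ℝ] E8 => D.adjoint := by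
  let L : (E3 →L[ℝ] E8) →ₗ[ℝ] (E8 →L[ℝ] E3) :=
    { toFun := fun D => D.adjoint
      map_add' := fun a b => map_add _ a b
      map_smul' := fun c a => by simp }
  exact (LinearMap.toContinuousLinearMap L).contDiff

theorem eq_sum_inner_fderiv {u : E3 → E8} {y : E3} {w : Fin 3 → E3}
    (hw : Orthonormal ℝ fun i => fderiv ℝ u y (w i)) (v : E3) :
    v = ∑ i, ⟪fderiv ℝ u y (w i), fderiv ℝ u y v⟫ • w i := by
  have hli : LinearIndependent ℝ w := by
    apply LinearIndependent.of_comp (fderiv ℝ u y).toLinearMap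
    exact hw.linearIndependent
  have hspan : v ∈ Submodule.span ℝ (Set.range w) := by
    rw [hli.span_eq_top_of_card_eq_finrank (by simp)]
    trivial
  obtain ⟨c, rfl⟩ := (Submodule.mem_span_range_iff_exists_fun ℝ).1 hspan
  refine Finset.sum_congr rfl fun i _ => ?_
  congr 1
  simp only [map_sum, map_smul]
  exact (hw.inner_right_fintype c i).symm

theorem self_mem_span_sup_tangentPlane (u : E3 → E8) (y : E3) : u y ∈ Submodule.span ℝ {u y} ⊔ tangentPlane u y :=
  Submodule.mem_sup_left (Submodule.mem_span_singleton_self _)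

theorem fderiv_mem_span_sup_tangentPlane (u : E3 → E8) (y v : E3) :
    fderiv ℝ u y v ∈ Submodule.span ℝ {u y} ⊔ tangentPlane u y :=
  Submodule.mem_sup_right ⟨v, rfl⟩

theorem sub_normalProj_mem_span_sup_tangentPlane (u : E3 → E8) (y : E3) (x : E8) :
    x - normalProj u y x ∈ Submodule.span ℝ {u y} ⊔ tangentPlane u y := by
  have := Submodule.sub_starProjection_mem_orthogonal (K := normalSpace u y) x
  rwa [normalSpace, Submodule.orthogonal_orthogonal] at this

namespace IsSphereImmersionOn

variable {u : E3 → E8} {V : Set E3}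

theorem contDiffAt (hu : IsSphereImmersionOn u V) {y : E3} (hy : y ∈ V) : ContDiffAt ℝ ∞ u y :=
  hu.smooth.contDiffAt (hu.isOpen.mem_nhds hy)

theorem differentiableAt (hu : IsSphereImmersionOn u V) {y : E3} (hy : y ∈ V) :
    DifferentiableAt ℝ u y :=
  (hu.contDiffAt hy).differentiableAt (by simp)

theorem contDiffAt_fderiv (hu : IsSphereImmersionOn u V) {y : E3} (hy : y ∈ V) :
    ContDiffAt ℝ ∞ (fderiv ℝ u) y :=
  (hu.contDiffAt hy).fderiv_right (by simp)

theorem differentiableAt_fderiv (hu : IsSphereImmersionOn u V) {y : E3} (hy : y ∈ V) :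
    DifferentiableAt ℝ (fderiv ℝ u) y :=
  (hu.contDiffAt_fderiv hy).differentiableAt (by simp)

theorem differentiableAt_fderiv_apply (hu : IsSphereImmersionOn u V) {y : E3} (hy : y ∈ V)
    (w : E3) : DifferentiableAt ℝ (fun z => fderiv ℝ u z w) y :=
  (hu.differentiableAt_fderiv hy).clm_apply (differentiableAt_const w)

theorem inner_fderiv (hu : IsSphereImmersionOn u V) {y : E3} (hy : y ∈ V) (v : E3) :
    ⟪u y, fderiv ℝ u y v⟫ = 0 := by
  have h : (fun z => ⟪u z, u z⟫) =ᶠ[𝓝 y] fun _ => (1 : ℝ) := by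
    filter_upwards [hu.isOpen.mem_nhds hy] with z hz
    rw [real_inner_self_eq_norm_sq, hu.norm_eq z hz, one_pow]
  have h1 := (h.fderiv_eq (𝕜 := ℝ))
  have h2 := DFunLike.congr_fun h1 v
  simp only [fderiv_inner_apply ℝ (hu.differentiableAt hy) (hu.differentiableAt hy)] at h2
  rw [real_inner_comm (u y)] at h2
  simpa using h2

/-- With D the differential of u, the projection onto the tangent space is D (D*D)⁻¹ D*. This
explicit formula shows that `normalProj` depends smoothly on the point, so projecting constant
vectors gives enough smooth normal sections. -/
theorem normalProj_eq (hu : IsSphereImmersionOn u V) {y : E3} (hy : y ∈ V) :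
    normalProj u y = ContinuousLinearMap.id ℝ E8 - (innerSL ℝ (u y)).smulRight (u y)
      - fderiv ℝ u y ∘L ContinuousLinearMap.inverse ((fderiv ℝ u y).adjoint ∘L fderiv ℝ u y)
        ∘L (fderiv ℝ u y).adjoint := by
  ext1 x
  set D := fderiv ℝ u y with hD
  have hx : ∀ x', (D.adjoint ∘L D) (ContinuousLinearMap.inverse (D.adjoint ∘L D) x') = x' := by
    intro x'
    have := (isInvertible_adjoint_comp (hu.injective y hy)).self_comp_inverse
    exact congrArg (fun L => L x') this
  refine Submodule.eq_starProjection_of_mem_orthogonal ?_ ?_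
  · rw [mem_normalSpace_iff]
    constructor
    · simp only [sub_apply, inner_sub_right, ContinuousLinearMap.comp_apply,
        hD, hu.inner_fderiv hy]
      simp [inner_smul_right, hu.norm_eq y hy]
    · intro v
      have h2 : ⟪D v, D (ContinuousLinearMap.inverse (D.adjoint ∘L D) (D.adjoint x))⟫
          = ⟪D v, x⟫ := by
        rw [← ContinuousLinearMap.adjoint_inner_right, ← ContinuousLinearMap.comp_apply, hx,
          ContinuousLinearMap.adjoint_inner_right]
      have h3 : ⟪D v, u y⟫ = 0 := by rw [real_inner_comm]; exact hu.inner_fderiv hy v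
      simp only [sub_apply, inner_sub_right, ContinuousLinearMap.comp_apply]
      rw [← hD, h2]
      simp [inner_smul_right, h3]
  · rw [normalSpace]
    apply Submodule.le_orthogonal_orthogonal
    simp only [sub_apply, ContinuousLinearMap.id_apply, sub_sub,
      sub_sub_cancel]
    refine Submodule.add_mem_sup ?_ ⟨_, rfl⟩
    exact Submodule.smul_mem _ _ (Submodule.mem_span_singleton_self _)

theorem contDiffAt_normalProj (hu : IsSphereImmersionOn u V) {y : E3} (hy : y ∈ V) :
    ContDiffAt ℝ ∞ (normalProj u) y := by
  have h : normalProj u =ᶠ[𝓝 y] fun y => ContinuousLinearMap.id ℝ E8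
      - (innerSL ℝ (u y)).smulRight (u y)
      - fderiv ℝ u y ∘L ContinuousLinearMap.inverse ((fderiv ℝ u y).adjoint ∘L fderiv ℝ u y)
        ∘L (fderiv ℝ u y).adjoint := by
    filter_upwards [hu.isOpen.mem_nhds hy] with z hz using hu.normalProj_eq hz
  refine ContDiffAt.congr_of_eventuallyEq ?_ h
  have hD := hu.contDiffAt_fderiv hy
  have hA : ContDiffAt ℝ ∞ (fun z => (fderiv ℝ u z).adjoint) y :=
    contDiff_adjoint.contDiffAt.comp y hD
  have hG : ContDiffAt ℝ ∞ (fun z => (fderiv ℝ u z).adjoint ∘L fderiv ℝ u z) y := hA.clm_comp hD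
  have hI : ContDiffAt ℝ ∞ (fun z => ContinuousLinearMap.inverse
      ((fderiv ℝ u z).adjoint ∘L fderiv ℝ u z)) y := by
    obtain ⟨e, he⟩ := isInvertible_adjoint_comp (hu.injective y hy)
    have := contDiffAt_map_inverse (n := ∞) (𝕜 := ℝ) e
    rw [he] at this
    exact this.comp y hG
  refine (contDiffAt_const.sub ?_).sub (hD.clm_comp (hI.clm_comp hA))
  exact ((innerSL ℝ : E8 →L[ℝ] E8 →L[ℝ] ℝ).contDiff.contDiffAt.comp y
    (hu.contDiffAt hy)).smulRight (hu.contDiffAt hy)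

/-! ### The Weingarten and Ricci equations -/

theorem fderiv_fderiv_apply (hu : IsSphereImmersionOn u V) {y : E3} (hy : y ∈ V) (v w : E3) :
    fderiv ℝ (fun z => fderiv ℝ u z w) y v = fderiv ℝ (fderiv ℝ u) y v w := by
  rw [fderiv_clm_apply (hu.differentiableAt_fderiv hy) (differentiableAt_const w)]
  simp

theorem secondFF_eq (hu : IsSphereImmersionOn u V) {y : E3} (hy : y ∈ V) (v w : E3) :
    secondFF u y v w = normalProj u y (fderiv ℝ (fderiv ℝ u) y v w) := by
  rw [secondFF, hu.fderiv_fderiv_apply hy]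

theorem secondFF_comm (hu : IsSphereImmersionOn u V) {y : E3} (hy : y ∈ V) (v w : E3) :
    secondFF u y v w = secondFF u y w v := by
  rw [hu.secondFF_eq hy, hu.secondFF_eq hy,
    ((hu.contDiffAt hy).isSymmSndFDerivAt (by simpa using ENat.LEInfty.out)).eq]

theorem secondFF_eq_zero (hu : IsSphereImmersionOn u V) {y : E3} (hy : y ∈ V) {w : Fin 3 → E3}
    (hw : Orthonormal ℝ fun i => fderiv ℝ u y (w i))
    (h : ∀ i j, secondFF u y (w i) (w j) = 0) (v v' : E3) : secondFF u y v v' = 0 := by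
  simp only [hu.secondFF_eq hy] at h ⊢
  rw [eq_sum_inner_fderiv hw v, eq_sum_inner_fderiv hw v']
  simp [h]

/-- Weingarten's equation. -/
theorem inner_fderiv_normal (hu : IsSphereImmersionOn u V) {y : E3} (hy : y ∈ V) {ξ : E3 → E8}
    (hξ : DifferentiableAt ℝ ξ y) (hn : ∀ᶠ z in 𝓝 y, ξ z ∈ normalSpace u z) (v w : E3) :
    ⟪fderiv ℝ u y w, fderiv ℝ ξ y v⟫ = -⟪secondFF u y v w, ξ y⟫ := by
  have h : (fun z => ⟪fderiv ℝ u z w, ξ z⟫) =ᶠ[𝓝 y] fun _ => (0 : ℝ) := by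
    filter_upwards [hn] with z hz using (mem_normalSpace_iff.1 hz).2 w
  have h2 := DFunLike.congr_fun (h.fderiv_eq (𝕜 := ℝ)) v
  simp only [fderiv_inner_apply ℝ (hu.differentiableAt_fderiv_apply hy w) hξ] at h2
  rw [secondFF, inner_normalProj_of_mem hn.self_of_nhds]
  rw [show fderiv ℝ (fun _ : E3 => (0 : ℝ)) y v = 0 by simp] at h2
  linarith

theorem inner_self_fderiv_normal (hu : IsSphereImmersionOn u V) {y : E3} (hy : y ∈ V)
    {ξ : E3 → E8} (hξ : DifferentiableAt ℝ ξ y) (hn : ∀ᶠ z in 𝓝 y, ξ z ∈ normalSpace u z)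
    (v : E3) : ⟪u y, fderiv ℝ ξ y v⟫ = 0 := by
  have h : (fun z => ⟪u z, ξ z⟫) =ᶠ[𝓝 y] fun _ => (0 : ℝ) := by
    filter_upwards [hn] with z hz using (mem_normalSpace_iff.1 hz).1
  have h2 := DFunLike.congr_fun (h.fderiv_eq (𝕜 := ℝ)) v
  simp only [fderiv_inner_apply ℝ (hu.differentiableAt hy) hξ] at h2
  rw [show fderiv ℝ (fun _ : E3 => (0 : ℝ)) y v = 0 by simp] at h2
  rw [(mem_normalSpace_iff.1 hn.self_of_nhds).2 v] at h2
  linarith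

theorem sub_normalProj_eq_sum (hu : IsSphereImmersionOn u V) {y : E3} (hy : y ∈ V)
    {w : Fin 3 → E3} (hw : Orthonormal ℝ fun i => fderiv ℝ u y (w i)) {x : E8}
    (hx : ⟪u y, x⟫ = 0) :
    x - normalProj u y x = ∑ i, ⟪fderiv ℝ u y (w i), x⟫ • fderiv ℝ u y (w i) := by
  have h : normalProj u y x = x - ∑ i, ⟪fderiv ℝ u y (w i), x⟫ • fderiv ℝ u y (w i) := by
    refine Submodule.eq_starProjection_of_mem_orthogonal ?_ ?_
    · rw [mem_normalSpace_iff]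
      constructor
      · simp [inner_sub_right, inner_sum, inner_smul_right, hu.inner_fderiv hy, hx]
      · intro v
        rw [eq_sum_inner_fderiv hw v]
        simp only [map_sum, map_smul, sum_inner, inner_smul_left]
        refine Finset.sum_eq_zero fun i _ => ?_
        rw [inner_sub_right, hw.inner_right_fintype, sub_self, mul_zero]
    · rw [sub_sub_cancel]
      refine Submodule.sum_mem _ fun i _ => Submodule.smul_mem _ _ ?_
      exact Submodule.le_orthogonal_orthogonal _ (fderiv_mem_span_sup_tangentPlane u y _)
  rw [h, sub_sub_cancel]

theorem differentiableAt_normalDeriv (hu : IsSphereImmersionOn u V) {y : E3} (hy : y ∈ V)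
    {ξ : E3 → E8} (hξ : ContDiffAt ℝ ∞ ξ y) (v : E3) :
    DifferentiableAt ℝ (normalDeriv u v ξ) y := by
  have h1 : DifferentiableAt ℝ (fderiv ℝ ξ) y :=
    (hξ.fderiv_right (m := ∞) (by simp)).differentiableAt (by simp)
  exact ((hu.contDiffAt_normalProj hy).differentiableAt (by simp)).clm_apply
    (h1.clm_apply (differentiableAt_const v))

/-- Differentiating ⟨∇_v' ξ, η⟩ = ⟨dξ(v'), η⟩ leaves, besides the second derivative of ξ, the
tangential part of dξ(v') paired with dη(v). Weingarten's equation expresses it through `secondFF`;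
the second derivative cancels on antisymmetrizing, which gives the Ricci equation. -/
theorem inner_normalDeriv_normalDeriv (hu : IsSphereImmersionOn u V) {y : E3} (hy : y ∈ V)
    {w : Fin 3 → E3} (hw : Orthonormal ℝ fun i => fderiv ℝ u y (w i)) {ξ η : E3 → E8}
    (hξ : ContDiffAt ℝ ∞ ξ y) (hξn : ∀ᶠ z in 𝓝 y, ξ z ∈ normalSpace u z)
    (hη : DifferentiableAt ℝ η y) (hηn : ∀ᶠ z in 𝓝 y, η z ∈ normalSpace u z) (v v' : E3) :
    ⟪normalDeriv u v (normalDeriv u v' ξ) y, η y⟫ = ⟪fderiv ℝ (fderiv ℝ ξ) y v v', η y⟫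
      + ∑ i, ⟪secondFF u y v' (w i), ξ y⟫ * ⟪secondFF u y v (w i), η y⟫ := by
  have hξd : DifferentiableAt ℝ ξ y := hξ.differentiableAt (by simp)
  have h1 : DifferentiableAt ℝ (fderiv ℝ ξ) y :=
    (hξ.fderiv_right (m := ∞) (by simp)).differentiableAt (by simp)
  have h2 : DifferentiableAt ℝ (fun z => fderiv ℝ ξ z v') y :=
    h1.clm_apply (differentiableAt_const v')
  have h3 := hu.differentiableAt_normalDeriv hy hξ v'
  have h : (fun z => ⟪normalDeriv u v' ξ z, η z⟫) =ᶠ[𝓝 y] fun z => ⟪fderiv ℝ ξ z v', η z⟫ := by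
    filter_upwards [hηn] with z hz using inner_normalProj_of_mem hz _
  have h4 := DFunLike.congr_fun (h.fderiv_eq (𝕜 := ℝ)) v
  rw [fderiv_inner_apply ℝ h3 hη, fderiv_inner_apply ℝ h2 hη, fderiv_clm_apply h1
    (differentiableAt_const v')] at h4
  simp only [fderiv_fun_const, Pi.zero_apply, ContinuousLinearMap.comp_zero, zero_add,
    ContinuousLinearMap.flip_apply] at h4
  have h5 := hu.sub_normalProj_eq_sum hy hw (hu.inner_self_fderiv_normal hy hξd hξn v')
  have h6 : ⟪fderiv ℝ ξ y v' - normalDeriv u v' ξ y, fderiv ℝ η y v⟫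
      = ∑ i, ⟪secondFF u y v' (w i), ξ y⟫ * ⟪secondFF u y v (w i), η y⟫ := by
    rw [normalDeriv, h5, sum_inner]
    refine Finset.sum_congr rfl fun i _ => ?_
    rw [inner_smul_left, hu.inner_fderiv_normal hy hξd hξn, hu.inner_fderiv_normal hy hη hηn]
    simp
  rw [inner_sub_left] at h6
  rw [normalDeriv, inner_normalProj_of_mem hηn.self_of_nhds, ← h6]
  linarith

/-- The Ricci equation. -/
theorem inner_normalCurvature (hu : IsSphereImmersionOn u V) {y : E3} (hy : y ∈ V)
    {w : Fin 3 → E3} (hw : Orthonormal ℝ fun i => fderiv ℝ u y (w i)) {ξ η : E3 → E8}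
    (hξ : ContDiffAt ℝ ∞ ξ y) (hξn : ∀ᶠ z in 𝓝 y, ξ z ∈ normalSpace u z)
    (hη : DifferentiableAt ℝ η y) (hηn : ∀ᶠ z in 𝓝 y, η z ∈ normalSpace u z) (v v' : E3) :
    ⟪normalCurvature u v v' ξ y, η y⟫ =
      ∑ i, (⟪secondFF u y v' (w i), ξ y⟫ * ⟪secondFF u y v (w i), η y⟫
        - ⟪secondFF u y v (w i), ξ y⟫ * ⟪secondFF u y v' (w i), η y⟫) := by
  rw [normalCurvature, inner_sub_left, hu.inner_normalDeriv_normalDeriv hy hw hξ hξn hη hηn,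
    hu.inner_normalDeriv_normalDeriv hy hw hξ hξn hη hηn, Finset.sum_sub_distrib,
    (hξ.isSymmSndFDerivAt (by simpa using ENat.LEInfty.out)).eq]
  ring

theorem contDiffAt_normalProj_const (hu : IsSphereImmersionOn u V) {y : E3} (hy : y ∈ V)
    (n : E8) : ContDiffAt ℝ ∞ (fun z => normalProj u z n) y :=
  (hu.contDiffAt_normalProj hy).clm_apply contDiffAt_const

theorem normalCurvature_eq_zero (hu : IsSphereImmersionOn u V) {y : E3} (hy : y ∈ V)
    {w : Fin 3 → E3} (hw : Orthonormal ℝ fun i => fderiv ℝ u y (w i))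
    (h : ∀ v v', secondFF u y v v' = 0) {ξ : E3 → E8}
    (hξ : ContDiffAt ℝ ∞ ξ y) (hξn : ∀ᶠ z in 𝓝 y, ξ z ∈ normalSpace u z) (v v' : E3) :
    normalCurvature u v v' ξ y = 0 := by
  -- The Ricci equation is tested against a normal extension of the curvature vector itself, giving
  -- |n|² = 0.
  set n := normalCurvature u v v' ξ y with hn
  have hmem : n ∈ normalSpace u y := Submodule.sub_mem _ (normalProj_mem _ _ _)
    (normalProj_mem _ _ _)
  have := hu.inner_normalCurvature hy hw hξ hξn (η := fun z => normalProj u z n)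
    ((hu.contDiffAt_normalProj_const hy n).differentiableAt (by simp))
    (Filter.Eventually.of_forall fun z => normalProj_mem _ _ _) v v'
  rw [normalProj_eq_self hmem, ← hn] at this
  rw [← inner_self_eq_zero (𝕜 := ℝ), this]
  simp [h]

end IsSphereImmersionOn

/-! ### Calibrated tangent planes and flat normal bundles -/

/-- Symmetry of `∑ i, x i ⊗ y i` implies that a skew form vanishes on it. -/
theorem sum_skew_eq_zero {ι : Type*} [Fintype ι] (B : E8 →ₗ[ℝ] E8 →ₗ[ℝ] ℝ)
    (hB : ∀ x y, B x y = -B y x) (x y : ι → E8)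
    (h : ∀ m n : E8, ∑ i, (⟪x i, m⟫ * ⟪y i, n⟫ - ⟪y i, m⟫ * ⟪x i, n⟫) = 0) :
    ∑ i, B (x i) (y i) = 0 := by
  let b := EuclideanSpace.basisFun (Fin 8) ℝ
  have hsum : ∀ m : E8, ∑ i, ⟪x i, m⟫ • y i = ∑ i, ⟪y i, m⟫ • x i := by
    intro m
    refine ext_inner_right ℝ fun n => ?_
    simp only [sum_inner, inner_smul_left]
    rw [← sub_eq_zero, ← Finset.sum_sub_distrib]
    exact h m n
  -- Expanding the second argument in a basis shows that the sum depends only on the tensor ∑ p_i ⊗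
  -- q_i.
  have hexp : ∀ p q : ι → E8, ∑ i, B (p i) (q i) = ∑ j, B (∑ i, ⟪q i, b j⟫ • p i) (b j) := by
    intro p q
    simp only [map_sum, map_smul, LinearMap.sum_apply, LinearMap.smul_apply]
    rw [Finset.sum_comm]
    refine Finset.sum_congr rfl fun i _ => ?_
    conv_lhs => rw [← b.sum_repr' (q i)]
    simp only [map_sum, map_smul]
    refine Finset.sum_congr rfl fun j _ => ?_
    rw [real_inner_comm]
  have h1 : ∑ i, B (x i) (y i) = ∑ i, B (y i) (x i) := by
    rw [hexp x y, hexp y x]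
    simp only [hsum]
  have h2 : ∑ i, B (x i) (y i) = -∑ i, B (y i) (x i) := by
    rw [← Finset.sum_neg_distrib]
    exact Finset.sum_congr rfl fun i _ => hB _ _
  linarith

/-- The 2-form `Φ₀(a, b, ·, ·)`. -/
noncomputable def phiForm (a b : E8) : E8 →ₗ[ℝ] E8 →ₗ[ℝ] ℝ :=
  LinearMap.mk₂ ℝ (fun x y => Phi a b x y) (fun x x' y => Phi_add₃ _ _ _ _ _)
    (fun t x y => by simp only [Phi, dx_eq, PiLp.smul_apply, smul_eq_mul]; ring)
    (fun x y y' => Phi_add₄ _ _ _ _ _) (fun t x y => by rw [Phi_smul₄]; rfl)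

/-- The component of x orthogonal to the Cayley plane is killed by the first variation, so only its
component along `w 3` survives: the cross product of `w 1` and `w 2` at `w 0` is `w 3`. -/
theorem Phi_eq_inner_of_calibrated {w : Fin 4 → E8} (hw : Orthonormal ℝ w)
    (h : Phi (w 0) (w 1) (w 2) (w 3) = 1) (x : E8) :
    Phi (w 0) (w 1) (w 2) x = ⟪w 3, x⟫ := by
  have h0 : Phi (w 0) (w 1) (w 2) (w 0) = 0 := by simp only [Phi, dx_eq]; ring
  have h1 : Phi (w 0) (w 1) (w 2) (w 1) = 0 := by simp only [Phi, dx_eq]; ring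
  have h2 : Phi (w 0) (w 1) (w 2) (w 2) = 0 := by simp only [Phi, dx_eq]; ring
  have hz : Phi (w 0) (w 1) (w 2) (x - ∑ i, ⟪w i, x⟫ • w i) = 0 := by
    refine Phi_eq_zero_of_mem_span hw (by rw [phiAlt_apply, h, one_pow])
      (Submodule.subset_span ⟨0, rfl⟩) (Submodule.subset_span ⟨1, rfl⟩)
      (Submodule.subset_span ⟨2, rfl⟩) fun i => ?_
    rw [inner_sub_right, hw.inner_right_fintype, sub_self]
  have hx : x = (x - ∑ i, ⟪w i, x⟫ • w i) + ∑ i, ⟪w i, x⟫ • w i := by abel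
  conv_lhs => rw [hx]
  rw [Phi_add₄, hz, Fin.sum_univ_four]
  simp only [Phi_add₄, Phi_smul₄, h0, h1, h2, h]
  ring

/-- The orthonormal bases of the tangent space at `u y` are calibrated up to sign. -/
def IsCalibratedAt (u : E3 → E8) (y : E3) : Prop :=
  ∀ e : Fin 3 → E8, Orthonormal ℝ e → (∀ i, e i ∈ tangentPlane u y) →
    Phi (u y) (e 0) (e 1) (e 2) ^ 2 = 1

namespace IsSphereImmersionOn

variable {u : E3 → E8} {V : Set E3}

theorem exists_orthonormal (hu : IsSphereImmersionOn u V) {y : E3} (hy : y ∈ V) :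
    ∃ w : Fin 3 → E3, Orthonormal ℝ fun i => fderiv ℝ u y (w i) := by
  have hf : Module.finrank ℝ (tangentPlane u y) = 3 := by
    rw [tangentPlane, LinearMap.finrank_range_of_inj (hu.injective y hy)]
    simp
  let b := (stdOrthonormalBasis ℝ (tangentPlane u y)).reindex (finCongr hf)
  choose w hw using fun i => (b i).2
  refine ⟨w, ?_⟩
  have h : (fun i => fderiv ℝ u y (w i)) = fun i => (b i : E8) := funext hw
  rw [h]
  exact b.orthonormal.comp_linearIsometry (tangentPlane u y).subtypeₗᵢ

theorem orthonormal_vecCons (hu : IsSphereImmersionOn u V) {y : E3} (hy : y ∈ V)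
    {e : Fin 3 → E8} (he : Orthonormal ℝ e) (ht : ∀ i, e i ∈ tangentPlane u y) :
    Orthonormal ℝ (Matrix.vecCons (u y) e) := by
  refine orthonormal_vecCons_iff.2 ⟨hu.norm_eq y hy, fun i => ?_, he⟩
  obtain ⟨v, hv⟩ := ht i
  rw [← hv]
  exact hu.inner_fderiv hy v

theorem exists_positive_frame (hu : IsSphereImmersionOn u V) {y : E3} (hy : y ∈ V)
    (hc : IsCalibratedAt u y) : ∃ w : Fin 3 → E3, (Orthonormal ℝ fun i => fderiv ℝ u y (w i)) ∧
      Phi (u y) (fderiv ℝ u y (w 0)) (fderiv ℝ u y (w 1)) (fderiv ℝ u y (w 2)) = 1 := by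
  obtain ⟨w, hw⟩ := hu.exists_orthonormal hy
  have h := hc _ hw fun i => ⟨w i, rfl⟩
  rcases sq_eq_one_iff.1 h with h1 | h1
  · exact ⟨w, hw, h1⟩
  · refine ⟨w ∘ Equiv.swap 0 1, hw.comp _ (Equiv.swap 0 1).injective, ?_⟩
    simp only [Function.comp_apply, Equiv.swap_apply_left, Equiv.swap_apply_right]
    rw [Equiv.swap_apply_of_ne_of_ne (by decide) (by decide), Phi_neg_of_swap₂₃, h1, neg_neg]

theorem Phi_eq_zero_of_mem (hu : IsSphereImmersionOn u V) {y : E3} (hy : y ∈ V)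
    (hc : IsCalibratedAt u y) {x₁ x₂ x₃ n : E8}
    (h₁ : x₁ ∈ Submodule.span ℝ {u y} ⊔ tangentPlane u y)
    (h₂ : x₂ ∈ Submodule.span ℝ {u y} ⊔ tangentPlane u y)
    (h₃ : x₃ ∈ Submodule.span ℝ {u y} ⊔ tangentPlane u y) (hn : n ∈ normalSpace u y) :
    Phi x₁ x₂ x₃ n = 0 := by
  obtain ⟨w, hw⟩ := hu.exists_orthonormal hy
  set e : Fin 3 → E8 := fun i => fderiv ℝ u y (w i) with he
  have hon := hu.orthonormal_vecCons hy hw fun i => ⟨w i, rfl⟩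
  have hle : Submodule.span ℝ {u y} ⊔ tangentPlane u y
      ≤ Submodule.span ℝ (Set.range (Matrix.vecCons (u y) e)) := by
    refine sup_le ?_ ?_
    · rw [Submodule.span_singleton_le_iff_mem]
      exact Submodule.subset_span ⟨0, rfl⟩
    · rintro _ ⟨v, rfl⟩
      change fderiv ℝ u y v ∈ _
      rw [eq_sum_inner_fderiv hw v, map_sum]
      refine Submodule.sum_mem _ fun i _ => ?_
      rw [map_smul]
      exact Submodule.smul_mem _ _ (Submodule.subset_span ⟨i.succ, rfl⟩)
  refine Phi_eq_zero_of_mem_span hon ?_ (hle h₁) (hle h₂) (hle h₃) ?_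
  · rw [phiAlt_apply]
    exact hc e hw fun i => ⟨w i, rfl⟩
  · rw [mem_normalSpace_iff] at hn
    intro i
    refine Fin.cases ?_ (fun j => ?_) i
    · exact hn.1
    · exact hn.2 _

/-- The linear equations satisfied by the second fundamental form of an associative 3-fold. -/
theorem inner_secondFF_of_calibrated (hu : IsSphereImmersionOn u V)
    (hc : ∀ y ∈ V, IsCalibratedAt u y) {y : E3} (hy : y ∈ V) {a b c : E3}
    (habc : ∀ x, Phi (u y) (fderiv ℝ u y a) (fderiv ℝ u y b) x = ⟪fderiv ℝ u y c, x⟫)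
    {n : E8} (hn : n ∈ normalSpace u y) (v : E3) :
    ⟪secondFF u y v c, n⟫ = Phi (u y) (secondFF u y v a) (fderiv ℝ u y b) n
      + Phi (u y) (fderiv ℝ u y a) (secondFF u y v b) n := by
  have hξ : DifferentiableAt ℝ (fun z => normalProj u z n) y :=
    (hu.contDiffAt_normalProj_const hy n).differentiableAt (by simp)
  have hξn : ∀ᶠ z in 𝓝 y, normalProj u z n ∈ normalSpace u z :=
    Filter.Eventually.of_forall fun z => normalProj_mem _ _ _
  -- Two tangent vectors and the position vector lie in the Cayley plane, so this function vanishes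
  -- identically near y. In its derivative the first term vanishes for the same reason, and the last
  -- is -⟨II(v, c), n⟩ by Weingarten's equation.
  have h0 : (fun z => Phi (u z) (fderiv ℝ u z a) (fderiv ℝ u z b) (normalProj u z n))
      =ᶠ[𝓝 y] fun _ => (0 : ℝ) := by
    filter_upwards [hu.isOpen.mem_nhds hy] with z hz
    exact hu.Phi_eq_zero_of_mem hz (hc z hz) (self_mem_span_sup_tangentPlane _ _) (fderiv_mem_span_sup_tangentPlane _ _ _)
      (fderiv_mem_span_sup_tangentPlane _ _ _) (normalProj_mem _ _ _)
  have h1 := DFunLike.congr_fun (h0.fderiv_eq (𝕜 := ℝ)) v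
  rw [show fderiv ℝ (fun _ : E3 => (0 : ℝ)) y v = 0 by simp,
    fderiv_Phi (hu.differentiableAt hy) (hu.differentiableAt_fderiv_apply hy a)
      (hu.differentiableAt_fderiv_apply hy b) hξ, habc,
    hu.inner_fderiv_normal hy hξ hξn, normalProj_eq_self hn,
    hu.Phi_eq_zero_of_mem hy (hc y hy) (fderiv_mem_span_sup_tangentPlane u y v) (fderiv_mem_span_sup_tangentPlane _ _ _)
      (fderiv_mem_span_sup_tangentPlane _ _ _) hn] at h1
  have split : ∀ x, x = normalProj u y x + (x - normalProj u y x) := fun x => by abel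
  have ha : Phi (u y) (fderiv ℝ (fun z => fderiv ℝ u z a) y v) (fderiv ℝ u y b) n
      = Phi (u y) (secondFF u y v a) (fderiv ℝ u y b) n := by
    conv_lhs => rw [split (fderiv ℝ (fun z => fderiv ℝ u z a) y v)]
    rw [Phi_add₂, hu.Phi_eq_zero_of_mem hy (hc y hy) (self_mem_span_sup_tangentPlane u y) (sub_normalProj_mem_span_sup_tangentPlane _ _ _)
      (fderiv_mem_span_sup_tangentPlane _ _ _) hn, add_zero]
    rfl
  have hb : Phi (u y) (fderiv ℝ u y a) (fderiv ℝ (fun z => fderiv ℝ u z b) y v) n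
      = Phi (u y) (fderiv ℝ u y a) (secondFF u y v b) n := by
    conv_lhs => rw [split (fderiv ℝ (fun z => fderiv ℝ u z b) y v)]
    rw [Phi_add₃, hu.Phi_eq_zero_of_mem hy (hc y hy) (self_mem_span_sup_tangentPlane u y) (fderiv_mem_span_sup_tangentPlane _ _ _)
      (sub_normalProj_mem_span_sup_tangentPlane _ _ _) hn, add_zero]
    rfl
  rw [ha, hb] at h1
  linarith

/-- An associative immersion whose normal connection is flat at a point is totally geodesic
there. -/
theorem secondFF_eq_zero_of_flat (hu : IsSphereImmersionOn u V)
    (hc : ∀ y ∈ V, IsCalibratedAt u y) {y : E3} (hy : y ∈ V)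
    (hflat : ∀ (v w : E3) (ξ : E3 → E8), ContDiffAt ℝ ∞ ξ y →
      (∀ᶠ z in 𝓝 y, ξ z ∈ normalSpace u z) → normalCurvature u v w ξ y = 0) (v v' : E3) :
    secondFF u y v v' = 0 := by
  obtain ⟨w, hw, hpos⟩ := hu.exists_positive_frame hy (hc y hy)
  set e : Fin 3 → E8 := fun i => fderiv ℝ u y (w i) with he
  -- The Ricci equation for the normal projections of the constant vectors m and n.
  have hricci : ∀ (j k : Fin 3) (m n : E8), ∑ i,
      (⟪secondFF u y (w i) (w j), m⟫ * ⟪secondFF u y (w i) (w k), n⟫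
        - ⟪secondFF u y (w i) (w k), m⟫ * ⟪secondFF u y (w i) (w j), n⟫) = 0 := by
    intro j k m n
    have hsm : ∀ n : E8, ContDiffAt ℝ ∞ (fun z => normalProj u z n) y :=
      hu.contDiffAt_normalProj_const hy
    have hno : ∀ n : E8, ∀ᶠ z in 𝓝 y, normalProj u z n ∈ normalSpace u z :=
      fun n => Filter.Eventually.of_forall fun z => normalProj_mem _ _ _
    have h1 := hu.inner_normalCurvature hy hw (hsm m) (hno m)
      ((hsm n).differentiableAt (by simp)) (hno n) (w k) (w j)
    rw [hflat _ _ _ (hsm m) (hno m), inner_zero_left] at h1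
    have h2 : ∀ (v v' : E3) (n : E8), ⟪secondFF u y v v', normalProj u y n⟫
        = ⟪secondFF u y v v', n⟫ := by
      intro v v' n
      rw [← inner_normalProj_left]
      exact congrArg (fun x => ⟪x, n⟫) (normalProj_eq_self (normalProj_mem _ _ _))
    simp only [h2] at h1
    rw [h1]
    refine Finset.sum_congr rfl fun i _ => ?_
    rw [hu.secondFF_comm hy (w j), hu.secondFF_comm hy (w k)]
  have hskew : ∀ (c j k : Fin 3),
      ∑ i, Phi (u y) (e c) (secondFF u y (w i) (w j)) (secondFF u y (w i) (w k)) = 0 :=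
    fun c j k => sum_skew_eq_zero (phiForm (u y) (e c)) (fun x x' => Phi_neg_of_swap₃₄ _ _ _ _)
      _ _ (hricci j k)
  have step : ∀ a b c : Fin 3, Orthonormal ℝ ![e a, e b, e c] →
      Phi (u y) (e a) (e b) (e c) = 1 → ∀ i, secondFF u y (w i) (w c) = 0 := by
    intro a b c hon h1
    have hon4 := hu.orthonormal_vecCons hy hon
      (fun i => by fin_cases i <;> exact ⟨_, rfl⟩)
    -- The linear relation paired with II(e_i, e_c) itself. Summed over i, both terms on the right
    -- are instances of `hskew`.
    have hrel : ∀ i, ⟪secondFF u y (w i) (w c), secondFF u y (w i) (w c)⟫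
        = Phi (u y) (e a) (secondFF u y (w i) (w b)) (secondFF u y (w i) (w c))
          - Phi (u y) (e b) (secondFF u y (w i) (w a)) (secondFF u y (w i) (w c)) := by
      intro i
      have hn : secondFF u y (w i) (w c) ∈ normalSpace u y := normalProj_mem _ _ _
      rw [hu.inner_secondFF_of_calibrated hc hy (a := w a) (b := w b)
        (fun x => Phi_eq_inner_of_calibrated hon4 h1 x) hn, Phi_neg_of_swap₂₃ _ (e b)]
      ring
    have hsum : ∑ i, ⟪secondFF u y (w i) (w c), secondFF u y (w i) (w c)⟫ = 0 := by
      simp only [hrel]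
      rw [Finset.sum_sub_distrib, hskew, hskew, sub_zero]
    intro i
    have := (Finset.sum_eq_zero_iff_of_nonneg fun i _ => real_inner_self_nonneg).1 hsum i
      (Finset.mem_univ i)
    exact inner_self_eq_zero.1 this
  have hperm : ∀ σ : Equiv.Perm (Fin 3), Orthonormal ℝ ![e (σ 0), e (σ 1), e (σ 2)] := by
    intro σ
    convert hw.comp σ σ.injective using 1
    funext i
    fin_cases i <;> rfl
  have h2 := step 0 1 2 (hperm 1) hpos
  have h0 := step 1 2 0 (hperm (finRotate 3)) (by
    rw [← hpos]; simp only [Phi, dx_eq]; ring)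
  have h1 := step 2 0 1 (hperm (finRotate 3)⁻¹) (by
    rw [← hpos]; simp only [Phi, dx_eq]; ring)
  refine hu.secondFF_eq_zero hy hw (fun i j => ?_) v v'
  fin_cases j
  exacts [h0 i, h1 i, h2 i]

end IsSphereImmersionOn

/-! ### Moving frames and the tensor R⁻ -/

theorem eq_sum_inner_smul {g : Fin 8 → E8} (hg : Orthonormal ℝ g) (x : E8) :
    x = ∑ c, ⟪g c, x⟫ • g c := by
  have hspan : x ∈ Submodule.span ℝ (Set.range g) := by
    rw [hg.linearIndependent.span_eq_top_of_card_eq_finrank (by simp)]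
    trivial
  obtain ⟨c, rfl⟩ := (Submodule.mem_span_range_iff_exists_fun ℝ).1 hspan
  simp only [hg.inner_right_fintype]

theorem inner_eq_sum_inner_mul {g : Fin 8 → E8} (hg : Orthonormal ℝ g) (x x' : E8) :
    ⟪x, x'⟫ = ∑ c, ⟪g c, x⟫ * ⟪g c, x'⟫ := by
  conv_lhs => rw [eq_sum_inner_smul hg x]
  simp [sum_inner, inner_smul_left]

/-- The quadratic expression of `R⁻` in terms of the Maurer-Cartan form. -/
theorem quadratic_of_antiSelfDual {k l : Fin 8 → Fin 8 → ℝ} (hk : ∀ a b, k a b = -k b a)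
    (hl : ∀ a b, l a b = -l b a) {D : Fin 8 → Fin 8 → ℝ}
    (hk0 : k 0 4 = 0 ∧ k 0 5 = 0 ∧ k 0 6 = 0 ∧ k 0 7 = 0)
    (hl0 : l 0 4 = 0 ∧ l 0 5 = 0 ∧ l 0 6 = 0 ∧ l 0 7 = 0)
    (hD : ∀ a b, D a b = ∑ c, (k c a * l c b - l c a * k c b))
    (hR : ∀ i j, bracket ![D 5 4 - D 7 6, D 6 4 - D 5 7, D 5 6 - D 4 7] i j
      + ∑ m, (bracket ![k 5 4 - k 7 6, k 6 4 - k 5 7, k 5 6 - k 4 7] i m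
          * bracket ![l 5 4 - l 7 6, l 6 4 - l 5 7, l 5 6 - l 4 7] m j
        - bracket ![l 5 4 - l 7 6, l 6 4 - l 5 7, l 5 6 - l 4 7] i m
          * bracket ![k 5 4 - k 7 6, k 6 4 - k 5 7, k 5 6 - k 4 7] m j) = 0) :
    (∑ c : Fin 3, (k (![1, 2, 3] c) 4 * l (![1, 2, 3] c) 7 - k (![1, 2, 3] c) 5 * l (![1, 2, 3] c) 6
        + k (![1, 2, 3] c) 6 * l (![1, 2, 3] c) 5 - k (![1, 2, 3] c) 7 * l (![1, 2, 3] c) 4) = 0) ∧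
      (∑ c : Fin 3, (k (![1, 2, 3] c) 6 * l (![1, 2, 3] c) 4 - k (![1, 2, 3] c) 4 * l (![1, 2, 3] c) 6
        + k (![1, 2, 3] c) 7 * l (![1, 2, 3] c) 5 - k (![1, 2, 3] c) 5 * l (![1, 2, 3] c) 7) = 0) ∧
      (∑ c : Fin 3, (k (![1, 2, 3] c) 4 * l (![1, 2, 3] c) 5 - k (![1, 2, 3] c) 5 * l (![1, 2, 3] c) 4
        + k (![1, 2, 3] c) 7 * l (![1, 2, 3] c) 6 - k (![1, 2, 3] c) 6 * l (![1, 2, 3] c) 7) = 0) := by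
  have kd : ∀ a, k a a = 0 := fun a => by linarith [hk a a]
  have ld : ∀ a, l a a = 0 := fun a => by linarith [hl a a]
  obtain ⟨k4, k5, k6, k7⟩ := hk0
  obtain ⟨l4, l5, l6, l7⟩ := hl0
  have h10 := hR 1 0
  have h20 := hR 2 0
  have h21 := hR 2 1
  simp only [hD, Fin.sum_univ_eight, Fin.sum_univ_three, bracket, Matrix.of_apply,
    Matrix.cons_val', Matrix.cons_val_zero, Matrix.cons_val_one, Matrix.cons_val,
    k4, k5, k6, k7, l4, l5, l6, l7, kd, ld, hk 5 4, hk 6 4, hk 7 4, hk 6 5, hk 7 5, hk 7 6,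
    hl 5 4, hl 6 4, hl 7 4, hl 6 5, hl 7 5, hl 7 6] at h10 h20 h21 ⊢
  -- In the structure equation the summands with c = 4, …, 7 cancel against [γ] ∧ [γ], since the
  -- anti-self-dual projection of so(4) is a Lie algebra homomorphism. The summand c = 0 vanishes by
  -- hypothesis, so only c = 1, 2, 3 remain.
  refine ⟨?_, ?_, ?_⟩
  · linear_combination h10
  · linear_combination h20
  · linear_combination h21

namespace IsAdaptedFrame

variable {u : E3 → E8} {V : Set E3} {g : Fin 8 → E3 → E8}

theorem contDiffAt (hg : IsAdaptedFrame u V g) (hV : IsOpen V) {y : E3} (hy : y ∈ V)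
    (a : Fin 8) : ContDiffAt ℝ ∞ (g a) y :=
  (hg.smooth a).contDiffAt (hV.mem_nhds hy)

theorem differentiableAt (hg : IsAdaptedFrame u V g) (hV : IsOpen V) {y : E3} (hy : y ∈ V)
    (a : Fin 8) : DifferentiableAt ℝ (g a) y :=
  (hg.contDiffAt hV hy a).differentiableAt (by simp)

theorem differentiableAt_fderiv (hg : IsAdaptedFrame u V g) (hV : IsOpen V) {y : E3} (hy : y ∈ V)
    (a : Fin 8) : DifferentiableAt ℝ (fderiv ℝ (g a)) y :=
  ((hg.contDiffAt hV hy a).fderiv_right (m := ∞) (by simp)).differentiableAt (by simp)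

theorem mcForm_skew (hg : IsAdaptedFrame u V g) (hV : IsOpen V) {y : E3} (hy : y ∈ V)
    (a b : Fin 8) (v : E3) : mcForm g a b y v = -mcForm g b a y v := by
  have h : (fun z => ⟪g a z, g b z⟫) =ᶠ[𝓝 y] fun _ => if a = b then (1 : ℝ) else 0 := by
    filter_upwards [hV.mem_nhds hy] with z hz
    exact orthonormal_iff_ite.1 (hg.spin7 z hz).orthonormal a b
  have h1 := DFunLike.congr_fun (h.fderiv_eq (𝕜 := ℝ)) v
  rw [fderiv_inner_apply ℝ (hg.differentiableAt hV hy a) (hg.differentiableAt hV hy b),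
    show fderiv ℝ (fun _ : E3 => if a = b then (1 : ℝ) else 0) y v = 0 by simp,
    real_inner_comm (g b y)] at h1
  simp only [mcForm]
  linarith

/-- The Maurer-Cartan form takes values in the Lie algebra of Spin(7): this is the derivative of the
constancy of `Phi` on the frame. -/
theorem mcForm_sum_eq_zero (hg : IsAdaptedFrame u V g) (hV : IsOpen V) {y : E3} (hy : y ∈ V)
    (v : E3) (m : Fin 4 → Fin 8) :
    ∑ i, phiAlt (Function.update (stdVec ∘ m) i
      (WithLp.toLp 2 fun k => mcForm g k (m i) y v)) = 0 := by
  have hs := hg.spin7 y hy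
  have h : (fun z => Phi (g (m 0) z) (g (m 1) z) (g (m 2) z) (g (m 3) z)) =ᶠ[𝓝 y]
      fun _ => Phi (stdVec (m 0)) (stdVec (m 1)) (stdVec (m 2)) (stdVec (m 3)) := by
    filter_upwards [hV.mem_nhds hy] with z hz using (hg.spin7 z hz).phi_eq _ _ _ _
  have h1 := DFunLike.congr_fun (h.fderiv_eq (𝕜 := ℝ)) v
  rw [fderiv_Phi (hg.differentiableAt hV hy _) (hg.differentiableAt hV hy _)
    (hg.differentiableAt hV hy _) (hg.differentiableAt hV hy _),
    fderiv_fun_const] at h1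
  have h2 : ∀ i, phiAlt (Function.update (stdVec ∘ m) i
      (WithLp.toLp 2 fun k => mcForm g k (m i) y v))
      = phiAlt (Function.update ((fun a => g a y) ∘ m) i (fderiv ℝ (g (m i)) y v)) := by
    intro i
    rw [← hs.phiAlt_update]
    congr 2
    exact (eq_sum_inner_smul hs.orthonormal _).symm
  simp only [h2, Fin.sum_univ_four, phiAlt_apply]
  simpa [Function.update_apply] using h1

/-- The Maurer-Cartan structure equation. The second derivatives of the frame are symmetric and
cancel. -/
theorem fderiv_mcForm_sub (hg : IsAdaptedFrame u V g) (hV : IsOpen V) {y : E3} (hy : y ∈ V)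
    (a b : Fin 8) (v w : E3) :
    fderiv ℝ (fun z => mcForm g a b z w) y v - fderiv ℝ (fun z => mcForm g a b z v) y w
      = ∑ c, (mcForm g c a y v * mcForm g c b y w - mcForm g c a y w * mcForm g c b y v) := by
  have h : ∀ v w, fderiv ℝ (fun z => mcForm g a b z w) y v
      = ⟪g a y, fderiv ℝ (fderiv ℝ (g b)) y v w⟫
        + ∑ c, mcForm g c a y v * mcForm g c b y w := by
    intro v w
    have h1 : DifferentiableAt ℝ (fun z => fderiv ℝ (g b) z w) y :=
      (hg.differentiableAt_fderiv hV hy b).clm_apply (differentiableAt_const w)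
    simp only [mcForm]
    rw [fderiv_inner_apply ℝ (hg.differentiableAt hV hy a) h1,
      fderiv_clm_apply (hg.differentiableAt_fderiv hV hy b) (differentiableAt_const w),
      inner_eq_sum_inner_mul (hg.spin7 y hy).orthonormal (fderiv ℝ (g a) y v)]
    simp
  rw [h, h, ((hg.contDiffAt hV hy b).isSymmSndFDerivAt (by simpa using ENat.LEInfty.out)).eq,
    Finset.sum_sub_distrib]
  simp only [mul_comm (mcForm g _ a y w)]
  ring

theorem differentiableAt_mcForm (hg : IsAdaptedFrame u V g) (hV : IsOpen V) {y : E3} (hy : y ∈ V)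
    (a b : Fin 8) (v : E3) : DifferentiableAt ℝ (fun z => mcForm g a b z v) y :=
  (hg.differentiableAt hV hy a).inner ℝ
    ((hg.differentiableAt_fderiv hV hy b).clm_apply (differentiableAt_const v))

theorem RMinus_eq (hg : IsAdaptedFrame u V g) (hV : IsOpen V) {y : E3} (hy : y ∈ V)
    (i j : Fin 3) (v w : E3) {D : Fin 8 → Fin 8 → ℝ}
    (hD : ∀ a b, D a b = fderiv ℝ (fun z => mcForm g a b z w) y v
      - fderiv ℝ (fun z => mcForm g a b z v) y w) :
    RMinus g i j y v w = bracket ![D 5 4 - D 7 6, D 6 4 - D 5 7, D 5 6 - D 4 7] i j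
      + ∑ m, (bracket (gammaForm g y v) i m * bracket (gammaForm g y w) m j
        - bracket (gammaForm g y w) i m * bracket (gammaForm g y v) m j) := by
  have hd := hg.differentiableAt_mcForm hV hy
  have hsub : ∀ (a b c d : Fin 8) (v w : E3),
      fderiv ℝ (fun z => mcForm g a b z w - mcForm g c d z w) y v
        = fderiv ℝ (fun z => mcForm g a b z w) y v
          - fderiv ℝ (fun z => mcForm g c d z w) y v := by
    intro a b c d v w
    rw [fderiv_fun_sub (hd a b w) (hd c d w)]
    rfl
  have hb : ∀ (f : E3 → Fin 3 → ℝ) (v : E3) (i j : Fin 3),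
      fderiv ℝ (fun z => bracket (f z) i j) y v
        = bracket (fun k => fderiv ℝ (fun z => f z k) y v) i j := by
    intro f v i j
    fin_cases i <;> fin_cases j <;> simp [bracket]
  have hγ : ∀ v w : E3, (fun k => fderiv ℝ (fun z => gammaForm g z w k) y v)
      = ![fderiv ℝ (fun z => mcForm g 5 4 z w) y v - fderiv ℝ (fun z => mcForm g 7 6 z w) y v,
        fderiv ℝ (fun z => mcForm g 6 4 z w) y v - fderiv ℝ (fun z => mcForm g 5 7 z w) y v,
        fderiv ℝ (fun z => mcForm g 5 6 z w) y v - fderiv ℝ (fun z => mcForm g 4 7 z w) y v] := by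
    intro v w
    funext k
    fin_cases k <;> exact hsub _ _ _ _ _ _
  rw [RMinus, hb, hb, hγ, hγ]
  congr 1
  fin_cases i <;> fin_cases j <;> simp [bracket, hD] <;> ring

/-- If `R⁻` vanishes at a point, then so does the second fundamental form. -/
theorem secondFF_eq_zero (hg : IsAdaptedFrame u V g) (hV : IsOpen V) {V' : Set E3}
    (hu : IsSphereImmersionOn u V') {y : E3} (hy : y ∈ V) (hy' : y ∈ V')
    (hR : ∀ i j v w, RMinus g i j y v w = 0) (v v' : E3) : secondFF u y v v' = 0 := by
  have hon := (hg.spin7 y hy).orthonormal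
  have htan : ∀ c : Fin 3, ∃ w, fderiv ℝ u y w = g (![1, 2, 3] c) y := by
    intro c
    exact hg.tangent y hy _ (by fin_cases c <;> simp)
  choose w hw using htan
  have hwon : Orthonormal ℝ fun i => fderiv ℝ u y (w i) := by
    simp only [hw]
    exact hon.comp (![1, 2, 3] : Fin 3 → Fin 8) (by decide)
  have hnor : ∀ a : Fin 4, ∀ z ∈ V, g (![4, 5, 6, 7] a) z ∈ normalSpace u z := by
    intro a z hz
    exact hg.normal z hz _ (by fin_cases a <;> simp)
  have hnor' : ∀ a : Fin 4, ∀ᶠ z in 𝓝 y, g (![4, 5, 6, 7] a) z ∈ normalSpace u z :=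
    fun a => Filter.eventually_of_mem (hV.mem_nhds hy) (hnor a)
  have h0 : ∀ (a : Fin 4) v, mcForm g 0 (![4, 5, 6, 7] a) y v = 0 := by
    intro a v
    rw [mcForm, hg.position y hy]
    exact hu.inner_self_fderiv_normal hy' (hg.differentiableAt hV hy _) (hnor' a) v
  -- By Weingarten's equation the tangent-normal block of the Maurer-Cartan form is minus the second
  -- fundamental form. This is what makes it symmetric in the two tangent directions in `hzero`.
  have hII : ∀ (v : E3) (c : Fin 3) (a : Fin 4), mcForm g (![1, 2, 3] c) (![4, 5, 6, 7] a) y v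
      = -⟪secondFF u y v (w c), g (![4, 5, 6, 7] a) y⟫ := by
    intro v c a
    rw [mcForm, ← hw]
    exact hu.inner_fderiv_normal hy' (hg.differentiableAt hV hy _) (hnor' a) v _
  have hrel := fun v => spin7_relations (fun a b => hg.mcForm_skew hV hy a b v)
    (h0 0 v) (h0 1 v) (h0 2 v) (h0 3 v) (hg.mcForm_sum_eq_zero hV hy v)
  have hquad := fun v w => quadratic_of_antiSelfDual
    (fun a b => hg.mcForm_skew hV hy a b v) (fun a b => hg.mcForm_skew hV hy a b w)
    ⟨h0 0 v, h0 1 v, h0 2 v, h0 3 v⟩ ⟨h0 0 w, h0 1 w, h0 2 w, h0 3 w⟩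
    (fun a b => hg.fderiv_mcForm_sub hV hy a b v w)
    (fun i j => by
      rw [← hR i j v w]
      exact (hg.RMinus_eq hV hy i j v w fun _ _ => rfl).symm)
  have hzero := eq_zero_of_antiSelfDual_eq_zero
    (fun j c a => mcForm g (![1, 2, 3] c) (![4, 5, 6, 7] a) y (w j))
    (fun j c a => by simp only [hII]; rw [hu.secondFF_comm hy'])
    (fun j => (hrel (w j)).1) (fun j => (hrel (w j)).2.1) (fun j => (hrel (w j)).2.2.1)
    (fun j => (hrel (w j)).2.2.2)
    (fun i j => (hquad (w i) (w j)).1) (fun i j => (hquad (w i) (w j)).2.1)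
    (fun i j => (hquad (w i) (w j)).2.2)
  refine hu.secondFF_eq_zero hy' hwon (fun i j => ?_) v v'
  have hmem : secondFF u y (w i) (w j) ∈ normalSpace u y := normalProj_mem _ _ _
  rw [mem_normalSpace_iff] at hmem
  have hN : ∀ a : Fin 4, ⟪g (![4, 5, 6, 7] a) y, secondFF u y (w i) (w j)⟫ = 0 := by
    intro a
    have h1 := hzero i j a
    rw [hII] at h1
    rw [real_inner_comm]
    linarith
  have hT : ∀ c : Fin 3, ⟪g (![1, 2, 3] c) y, secondFF u y (w i) (w j)⟫ = 0 := by
    intro c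
    rw [← hw]
    exact hmem.2 _
  rw [eq_sum_inner_smul hon (secondFF u y (w i) (w j))]
  refine Finset.sum_eq_zero fun c _ => ?_
  have hc : ⟪g c y, secondFF u y (w i) (w j)⟫ = 0 := by
    fin_cases c
    · change ⟪g 0 y, _⟫ = 0
      rw [hg.position y hy]
      exact hmem.1
    exacts [hT 0, hT 1, hT 2, hN 0, hN 1, hN 2, hN 3]
  rw [hc, zero_smul]

end IsAdaptedFrame

/-! ### From the manifold to a chart -/

namespace IsSmoothImmersion

variable {M : Type*} [TopologicalSpace M] [ChartedSpace E3 M]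

theorem contMDiff_coe {F : M → S7} (hF : IsSmoothImmersion F) :
    ContMDiff (𝓡 3) 𝓘(ℝ, E8) ∞ fun q => (F q : E8) :=
  contMDiff_coe_sphere.comp hF.smooth

theorem diff_injective {F : M → S7} (hF : IsSmoothImmersion F) (p : M) :
    Function.Injective (diff F p) := by
  have h : diff F p = (mfderiv (𝓡 7) 𝓘(ℝ, E8) ((↑) : S7 → E8) (F p)).comp
      (mfderiv (𝓡 3) (𝓡 7) F p) :=
    mfderiv_comp p (contMDiff_coe_sphere (m := ∞) |>.mdifferentiable (by simp) _)
      (hF.smooth.mdifferentiable (by simp) p)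
  rw [h]
  exact (injective_mvfderiv_subtypeVal_sphere (F p)).comp (hF.injective p)

variable [IsManifold (𝓡 3) ∞ M]

theorem fderiv_param {F : M → S7} (hF : IsSmoothImmersion F) (p : M) {y : E3}
    (hy : y ∈ (extChartAt (𝓡 3) p).target) :
    ∃ L : E3 →L[ℝ] TangentSpace (𝓡 3) ((extChartAt (𝓡 3) p).symm y), Function.Injective L ∧
      ∀ v, fderiv ℝ (param F p) y v = diff F ((extChartAt (𝓡 3) p).symm y) (L v) := by
  have hinv := isInvertible_mfderivWithin_extChartAt_symm (I := 𝓡 3) hy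
  have hmd := mdifferentiableWithinAt_extChartAt_symm (I := 𝓡 3) hy
  rw [ModelWithCorners.range_eq_univ, mfderivWithin_univ] at hinv
  rw [ModelWithCorners.range_eq_univ, mdifferentiableWithinAt_univ] at hmd
  refine ⟨_, hinv.injective, fun v => ?_⟩
  have h := mfderiv_comp (I := 𝓘(ℝ, E3)) (I' := 𝓡 3) (I'' := 𝓘(ℝ, E8)) y
    (hF.contMDiff_coe.mdifferentiable (by simp) ((extChartAt (𝓡 3) p).symm y)) hmd
  rw [mfderiv_eq_fderiv] at h
  exact DFunLike.congr_fun h v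

theorem isSphereImmersionOn {F : M → S7} (hF : IsSmoothImmersion F) (p : M) :
    IsSphereImmersionOn (param F p) (extChartAt (𝓡 3) p).target where
  isOpen := isOpen_extChartAt_target p
  smooth := contMDiffOn_iff_contDiffOn.1
    (hF.contMDiff_coe.comp_contMDiffOn (contMDiffOn_extChartAt_symm p))
  norm_eq y _ := by simp [param]
  injective y hy := by
    obtain ⟨L, hL, h⟩ := hF.fderiv_param p hy
    have : ⇑(fderiv ℝ (param F p) y) = diff F ((extChartAt (𝓡 3) p).symm y) ∘ L := funext h
    rw [this]
    exact (hF.diff_injective _).comp hL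

theorem isCalibratedAt {F : M → S7} (hF : IsSmoothImmersion F)
    {o : ∀ p : M, Orientation ℝ (TangentSpace (𝓡 3) p) (Fin 3)} (hA : IsAssociative F o) (p : M)
    {y : E3} (hy : y ∈ (extChartAt (𝓡 3) p).target) : IsCalibratedAt (param F p) y := by
  intro e he ht
  obtain ⟨L, -, h⟩ := hF.fderiv_param p hy
  let q := (extChartAt (𝓡 3) p).symm y
  have ht' : ∀ i, ∃ x, diff F q x = e i := by
    intro i
    obtain ⟨v, hv⟩ := ht i
    exact ⟨L v, (h v).symm.trans hv⟩
  choose x hx using ht'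
  have hli : LinearIndependent ℝ x := by
    apply LinearIndependent.of_comp (diff F q).toLinearMap
    have : (diff F q).toLinearMap ∘ x = e := funext hx
    rw [this]
    exact he.linearIndependent
  have hfin : Fintype.card (Fin 3) = Module.finrank ℝ (TangentSpace (𝓡 3) q) := by
    change _ = Module.finrank ℝ E3
    simp
  let b := basisOfLinearIndependentOfCardEqFinrank hli hfin
  -- The given orthonormal basis need not be positively oriented. Adjusting it only changes signs,
  -- which affect neither its Gram determinant nor the square of `Phi`.
  have hsign : ∀ i, ∃ s : ℝ, s ^ 2 = 1 ∧ diff F q (b.adjustToOrientation (o q) i) = s • e i := by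
    intro i
    have hb : b i = x i := by simp [b]
    rcases b.adjustToOrientation_apply_eq_or_eq_neg (o q) i with h1 | h1
    · exact ⟨1, by simp, by rw [h1, hb, hx, one_smul]⟩
    · exact ⟨-1, by simp, by rw [h1, hb, map_neg, hx, neg_one_smul]⟩
  choose s hs hse using hsign
  have h1 := hA q (b.adjustToOrientation (o q)) (b.orientation_adjustToOrientation (o q))
  have hG : (Matrix.of fun i j => ⟪diff F q (b.adjustToOrientation (o q) i),
      diff F q (b.adjustToOrientation (o q) j)⟫) = 1 := by
    ext i j
    simp only [Matrix.of_apply, hse, inner_smul_left, inner_smul_right,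
      orthonormal_iff_ite.1 he i j, Matrix.one_apply]
    split_ifs with hij
    · subst hij
      simpa [pow_two] using hs i
    · simp
  rw [hG, Matrix.det_one, Real.sqrt_one, hse, hse, hse, phi] at h1
  have h2 : Phi (F q : E8) (s 0 • e 0) (s 1 • e 1) (s 2 • e 2)
      = s 0 * s 1 * s 2 * Phi (F q : E8) (e 0) (e 1) (e 2) := by
    simp only [Phi, dx_eq, PiLp.smul_apply, smul_eq_mul]; ring
  rw [h2] at h1
  have h3 : (s 0 * s 1 * s 2 * Phi (F q : E8) (e 0) (e 1) (e 2)) ^ 2 = 1 := by rw [h1, one_pow]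
  rw [mul_pow, mul_pow, mul_pow, hs, hs, hs] at h3
  rw [one_mul, one_mul, one_mul] at h3
  exact h3

end IsSmoothImmersion

end AssocS7

theorem mainTheorem9 {M : Type*} [TopologicalSpace M] [ChartedSpace AssocS7.E3 M]
    [IsManifold (𝓡 3) ∞ M] (F : M → AssocS7.S7)
    (o : ∀ p : M, Orientation ℝ (TangentSpace (𝓡 3) p) (Fin 3))
    (hF : AssocS7.IsSmoothImmersion F) (hA : AssocS7.IsAssociative F o) :
    (AssocS7.HasFlatNormalBundle F ↔ AssocS7.IsTotallyGeodesic F) ∧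
      (AssocS7.RMinusVanishes F → AssocS7.IsTotallyGeodesic F) := by
  refine ⟨⟨fun h p v w => ?_, fun h p v w ξ hξ hn => ?_⟩, fun h p v w => ?_⟩
  · exact (hF.isSphereImmersionOn p).secondFF_eq_zero_of_flat
      (fun y hy => hF.isCalibratedAt hA p hy) (mem_extChartAt_target p) (h p) v w
  · obtain ⟨e, he⟩ := (hF.isSphereImmersionOn p).exists_orthonormal (mem_extChartAt_target p)
    exact (hF.isSphereImmersionOn p).normalCurvature_eq_zero (mem_extChartAt_target p) he (h p)
      hξ hn v w
  · obtain ⟨V, g, hV, hpV, -, hg, hR⟩ := h p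
    exact hg.secondFF_eq_zero hV (hF.isSphereImmersionOn p) hpV (mem_extChartAt_target p) hR v w
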